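/- Let $N\ge 1$, and let $V,V_1:\mathbf R^N\to\mathbf R$ be measurable with $V\ge 0$ and $V_1=0$ wherever $V=0$ (in particular this holds for every $V_1$ if $V>0$). Assume that for some $\gamma>0$ and some $p\in[1,\infty]$ with $p>N/2$ the functions $e^{\gamma|x|}V$ and $e^{\gamma|x|}V_1$ belong to $L^p(\mathbf R^N)$. Let $G(x,y;z)$ be the Green's function of $-\Delta+z^2$, i.e. the integral kernel of $(-\Delta+z^2)^{-1}$ for $\operatorname{Re}z>0$, continued analytically in $z$ to $\mathbf C\setminus\{0\}$ if $N$ is odd and to $\mathbf C\setminus(-\infty,0]$ if $N$ is even. For a real potential $U$ put $X=|U|^{1/2}$, $W=U/X$ (with $W=0$ where $U=0$). The number $\lambda=-z^2$ is a resonance of $-\Delta+U$, with spectral parameter $z$ (so that $\sqrt{-\lambda}$ stands for $z$), if $0$ is an eigenvalue on $L^2(\mathbf R^N)$ of $$A(z)g(x)=\int_{\mathbf R^N} W(x)G(x,y;z)X(y)g(y)\,dy+g(x).$$ For $U=V$ one has $W=X=V^{1/2}$. With $W_1=V_1/(2V^{1/2})$ (and $W_1=0$ where $V=0$) put $$A'(z)g(x)=\int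 W(x)\frac{\partial G(x,y;z)}{\partial z}W(y)g(y)\,dy,$$ $$B(z)g(x)=\int W_1(x)G(x,y;z)W(y)g(y)\,dy+\int W(x)G(x,y;z)W_1(y)g(y)\,dy,$$ and $(u,v)=\int_{\mathbf R^N}u(x)v(x)\,dx$ (bilinear, without complex conjugation). Let $\lambda_0=-z_0^2$ be a resonance of $-\Delta+V$ with spectral parameter $z_0$, $\operatorname{Re}z_0>-\gamma/2$, let $0\ne g_0\in L^2(\mathbf R^N)$ satisfy $A(z_0)g_0=0$, assume $(A'(z_0)g_0,g_0)\neq0$, and put $$\nu=-\frac{(B(z_0)g_0,g_0)}{(A'(z_0)g_0,g_0)}.$$ (a) If the kernel of $A(z_0)$ is spanned by $g_0$, then there are $\delta,\varepsilon_0>0$ such that for every real $\varepsilon$ with $|\varepsilon|<\varepsilon_0$ the operator $-\Delta+V+\varepsilon V_1$ has exactly one resonance $\lambda=-z^2$ with spectral parameter $|z-z_0|<\delta$, and $$\lambda=\lambda_0-2\nu\sqrt{-\lambda_0}\,\varepsilon+O(\varepsilon^2),\qquad \sqrt{-\lambda_0}=z_0 .$$ (b) Without any assumption on the dimension of the kernel,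 the same expansion holds, as $\varepsilon\to0$ through any set of real values, for every family of resonances $\lambda(\varepsilon)=-z(\varepsilon)^2$ of $-\Delta+V+\varepsilon V_1$ with $z(\varepsilon)\to z_0$ whose eigenfunctions, i.e. the solutions $g(\varepsilon)$ of $A(z(\varepsilon))g(\varepsilon)=0$ for the potential $V+\varepsilon V_1$, satisfy $g(\varepsilon)=g_0+O(\varepsilon)$ in $L^2(\mathbf R^N)$. -/

import Mathlib

open MeasureTheory Filter Topology Asymptotics

namespace SchrodingerResonance

noncomputable section

/-- The space `ℝ^N` with its Euclidean norm and Lebesgue measure. -/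
abbrev Space (N : ℕ) : Type := EuclideanSpace ℝ (Fin N)

/-- The spectral parameters `z` (with `λ = -z²`) to which the Green's function of `-Δ + z²` is
continued from the half-plane `Re z > 0`: all `z ≠ 0` in odd dimensions, and the plane cut along
`(-∞, 0]` in even dimensions, where `z = 0` is a logarithmic branch point. -/
def sheet (N : ℕ) : Set ℂ := {z | z ≠ 0 ∧ (Even N → z ∈ Complex.slitPlane)}

/-- The Green's function of `-Δ + z²` on `ℝ^N` (`N ≥ 1`) at distance `r > 0`.  For `Re z > 0` it is
the integral kernel of `(-Δ + z²)⁻¹`, namely `(2π)^(-N/2) (z/r)^(N/2-1) K_{N/2-1}(z r)` with the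
modified Bessel function `K`; for the other `z` in `sheet N` it is the analytic continuation.
For `N = 1` it is `exp (-z r) / (2 z)`.  For `N ≥ 2` the classical representation
`K_ν(w) = (π/(2w))^(1/2) e^(-w) / Γ(ν+1/2) * ∫₀^∞ e^(-t) t^(ν-1/2) (1 + t/(2w))^(ν-1/2) dt`,
valid on the whole cut plane, is inserted and the powers of `z` and `r` are collected; in odd
dimensions the exponent `(N-3)/2` is a natural number and the formula is entire in `z`.
For `N = 3` it reduces to `exp (-z r) / (4 π r)`. -/
def greenRadial (N : ℕ) (z : ℂ) (r : ℝ) : ℂ :=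
  if N = 1 then Complex.exp (-(z * r)) / (2 * z)
  else
    Complex.exp (-(z * r)) /
        (((4 * Real.pi) ^ (((N : ℝ) - 1) / 2) * Real.Gamma (((N : ℝ) - 1) / 2) * r ^ (N - 2) : ℝ) : ℂ) *
      ∫ t in Set.Ioi (0 : ℝ),
        ((Real.exp (-t) * t ^ (((N : ℝ) - 3) / 2) : ℝ) : ℂ) *
          ((t : ℂ) + 2 * z * r) ^ (((N : ℂ) - 3) / 2)

/-- The Green's function `G(x, y; z)`. -/
def green {N : ℕ} (x y : Space N) (z : ℂ) : ℂ := greenRadial N z (dist x y)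

/-- The factor `X = |V|^(1/2)`. -/
def absRoot {N : ℕ} (V : Space N → ℝ) (x : Space N) : ℝ := Real.sqrt |V x|

/-- The factor `W = V / X` (zero where `V` vanishes), so that `V = W X`; if `V ≥ 0` then
`W = X = V^(1/2)`. -/
def signedRoot {N : ℕ} (V : Space N → ℝ) (x : Space N) : ℝ := V x / absRoot V x

/-- The Birman–Schwinger operator
`(A(z) g)(x) = ∫ W(x) G(x, y; z) X(y) g(y) dy + g(x)` of the potential `V`. -/
def opA {N : ℕ} (V : Space N → ℝ) (z : ℂ) (g : Space N → ℂ) (x : Space N) : ℂ :=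
  (∫ y, (signedRoot V x : ℂ) * green x y z * (absRoot V y : ℂ) * g y) + g x

/-- `g ∈ L²(ℝ^N)` solves `A(z) g = 0`, the integral defining `A(z) g` being absolutely convergent
at almost every point. -/
def InKernel {N : ℕ} (V : Space N → ℝ) (z : ℂ)
    (g : Lp ℂ 2 (volume : Measure (Space N))) : Prop :=
  (∀ᵐ x, Integrable fun y => (signedRoot V x : ℂ) * green x y z * (absRoot V y : ℂ) * g y) ∧
    ∀ᵐ x, opA V z g x = 0

/-- `λ = -z²` is a resonance of `-Δ + V`, with spectral parameter `z`:
`0` is an eigenvalue of `A(z)` on `L²(ℝ^N)`. -/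
def IsResonanceAt {N : ℕ} (V : Space N → ℝ) (z : ℂ) : Prop :=
  z ∈ sheet N ∧ ∃ g : Lp ℂ 2 (volume : Measure (Space N)), g ≠ 0 ∧ InKernel V z g

/-- The derivative in `z` of the Birman–Schwinger operator:
`(A'(z) g)(x) = ∫ W(x) ∂G(x, y; z)/∂z X(y) g(y) dy`. -/
def opA' {N : ℕ} (V : Space N → ℝ) (z : ℂ) (g : Space N → ℂ) (x : Space N) : ℂ :=
  ∫ y, (signedRoot V x : ℂ) * deriv (fun w => green x y w) z * (absRoot V y : ℂ) * g y

/-- The derivative of `(V + ε V₁)^(1/2)` at `ε = 0`, for `V ≥ 0`: `V₁ / (2 V^(1/2))`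
(set to zero where `V` vanishes). -/
def rootVariation {N : ℕ} (V V₁ : Space N → ℝ) (x : Space N) : ℝ :=
  V₁ x / (2 * Real.sqrt (V x))

/-- The first-order term `B(z)` in `ε` of the Birman–Schwinger operator of `V + ε V₁`, for `V ≥ 0`:
`(B(z) g)(x) = ∫ W₁(x) G(x, y; z) W(y) g(y) dy + ∫ W(x) G(x, y; z) W₁(y) g(y) dy`
with `W = V^(1/2)` and `W₁ = V₁ / (2 V^(1/2))`. -/
def opB {N : ℕ} (V V₁ : Space N → ℝ) (z : ℂ) (g : Space N → ℂ) (x : Space N) : ℂ :=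
  (∫ y, (rootVariation V V₁ x : ℂ) * green x y z * (absRoot V y : ℂ) * g y) +
    ∫ y, (signedRoot V x : ℂ) * green x y z * (rootVariation V V₁ y : ℂ) * g y

/-- The bilinear pairing `(u, v) = ∫ u v` (no complex conjugation), for which `A(z)` is symmetric
when `V ≥ 0`. -/
def pairing {N : ℕ} (u v : Space N → ℂ) : ℂ := ∫ x, u x * v x

/-- `ν = -(B(z) g, g) / (A'(z) g, g)`. -/
def nu {N : ℕ} (V V₁ : Space N → ℝ) (z : ℂ) (g : Space N → ℂ) : ℂ :=
  -pairing (opB V V₁ z g) g / pairing (opA' V z g) g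

end

end SchrodingerResonance

open SchrodingerResonance

/-!
The resonances of `-Δ + V + ε V₁` near `λ₀ = -z₀²` are found by analytic perturbation theory of the
Birman–Schwinger operator. Its factors `|V + ε V₁|^(1/2)` do not depend differentiably on `ε` where
`V` is small compared to `V₁`, so the square roots are removed first. With `Q = V + |V₁|`, put
`K(z) = Q^(1/2) (-Δ + z²)⁻¹ Q^(1/2)` and `a_ε = (V + ε V₁) / Q`, which is affine in `ε` and bounded
by one for `|ε| ≤ 1`. The equation `A(z) g = 0` for `V + ε V₁` is equivalent to
`f + K(z) (a_ε f) = 0`, under `f = K(z) (|a_ε|^(1/2) g)` and `g = -a_ε |a_ε|^(-1/2) f`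
(`inKernel_of_add_eq_zero`, `InKernel.spec`).

The family `K` is holomorphic near `z₀`, and `K(z₀)` is compact and symmetric for the bilinear
pairing (`exists_sandwichedGreen_family`). For this, the integral representation of the Green's
function gives, locally uniformly in `z`, the bound `e^(σ r) (1 + r^(-α))` with a suitable
`σ < γ / 2` (`exists_greenRadial_bound`). Since `p > N / 2`, the singularity `r^(-α)` is locally in
the space dual to `L^p`, and the kernel passes Schur's test with the weight `e^(σ |x|) Q(x)^(1/2)`
(`exists_schurBound`). A holomorphic family of kernels with a uniform Schur bound is a holomorphic
family of operators (`SchurBound.exists_holomorphic_family`), and cutting off the diagonal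
approximates `K(z₀)` in norm by Hilbert–Schmidt operators.

If `f₀` is the solution at `z₀`, then by symmetry `φ = (·, a₀ f₀)` vanishes on the range of
`1 + K(z₀) a₀`. Applying `φ` to the equation at `(ε, z(ε))` leaves
`(z(ε) - z₀) φ(K'(z₀) a₀ f₀) + ε φ(K(z₀) a₁ f₀) = O((|ε| + |z(ε) - z₀|)²)` with `a₁ = V₁ / Q`
(`isBigO_spectral_shift`). The two coefficients are `(A'(z₀) g₀, g₀)` and `(B(z₀) g₀, g₀)`
(`pairing_opA'_eq`, `pairing_opB_eq`), so `z(ε) = z₀ + ν ε + O(ε²)`, and squaring gives the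
expansion of the energy. For a simple kernel, adding a rank-one operator to `1 + K(z) a_ε` makes it
invertible by the Fredholm alternative, and turns the resonance condition into a scalar equation
which the implicit function theorem solves uniquely, because its `z`-derivative is, up to sign,
`φ(K'(z₀) a₀ f₀) ≠ 0` (`exists_unique_spectral_shift`).
-/

open scoped NNReal ENNReal

namespace SchrodingerResonance

/-! ### Schur's test -/

section IntegralOperators

lemma enorm_mul_le_of_norm_le {β : Type*} {q : β → ℝ} {g : β → β → ℝ} {k : β → β → ℂ}
    (hle : ∀ x y, ‖k x y‖ ≤ q x * g x y * q y) (f : β → ℂ) (x y : β) :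
    ‖k x y * f y‖ₑ ≤ ENNReal.ofReal (q x * g x y * q y) * ‖f y‖ₑ := by
  rw [enorm_mul]
  gcongr
  rw [← ofReal_norm]
  exact ENNReal.ofReal_le_ofReal (hle x y)

variable {α : Type*} [MeasurableSpace α] {μ : Measure α}

/-- The bounded operator `T` on `L²(μ)` is the integral operator with kernel `k`: for every `f`
the integral `∫ k(x, y) f(y) dy` converges absolutely at almost every `x`, and equals `T f`. -/
def HasKernel (T : Lp ℂ 2 μ →L[ℂ] Lp ℂ 2 μ) (k : α → α → ℂ) : Prop :=
  ∀ f : Lp ℂ 2 μ, (∀ᵐ x ∂μ, Integrable (fun y => k x y * f y) μ) ∧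
    T f =ᵐ[μ] fun x => ∫ y, k x y * f y ∂μ

/-- The data of a Schur test for kernels bounded by `q(x) g(x, y) q(y)` with `g` symmetric:
`∫ g(x, y) q(y)² dy ≤ M` for every `x`. -/
structure SchurBound (μ : Measure α) (q : α → ℝ) (g : α → α → ℝ) (M : ℝ≥0) : Prop where
  measurable_weight : Measurable q
  measurable_kernel : Measurable (Function.uncurry g)
  weight_nonneg : ∀ x, 0 ≤ q x
  kernel_nonneg : ∀ x y, 0 ≤ g x y
  symm : ∀ x y, g x y = g y x
  lintegral_le : ∀ x, ∫⁻ y, ENNReal.ofReal (g x y * q y ^ 2) ∂μ ≤ M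

lemma SchurBound.const_mul {q : α → ℝ} {g : α → α → ℝ} {M : ℝ≥0} (h : SchurBound μ q g M)
    (c : ℝ≥0) : SchurBound μ q (fun x y => c * g x y) (c * M) where
  measurable_weight := h.measurable_weight
  measurable_kernel := h.measurable_kernel.const_mul _
  weight_nonneg := h.weight_nonneg
  kernel_nonneg x y := mul_nonneg c.2 (h.kernel_nonneg x y)
  symm x y := by rw [h.symm]
  lintegral_le x := by
    simp_rw [mul_assoc, ENNReal.ofReal_mul (NNReal.coe_nonneg c)]
    rw [lintegral_const_mul', ENNReal.ofReal_coe_nnreal, ENNReal.coe_mul]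
    · gcongr; exact h.lintegral_le x
    · simp

lemma eLpNorm_two_eq {E : Type*} [NormedAddCommGroup E] (f : α → E) :
    eLpNorm f 2 μ = (∫⁻ x, ‖f x‖ₑ ^ 2 ∂μ) ^ (1 / 2 : ℝ) := by
  rw [eLpNorm_eq_lintegral_rpow_enorm_toReal (by norm_num) (by norm_num)]
  simp

lemma lintegral_sq_enorm_Lp (f : Lp ℂ 2 μ) :
    ∫⁻ x, ‖f x‖ₑ ^ 2 ∂μ = ENNReal.ofReal (‖f‖ ^ 2) := by
  rw [Lp.norm_def, ENNReal.ofReal_pow ENNReal.toReal_nonneg,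
    ENNReal.ofReal_toReal (Lp.eLpNorm_ne_top f), eLpNorm_two_eq, ← ENNReal.rpow_natCast,
    ← ENNReal.rpow_mul]
  norm_num

lemma sq_lintegral_mul_le {f g : α → ℝ≥0∞} (hf : AEMeasurable f μ) (hg : AEMeasurable g μ) :
    (∫⁻ x, f x * g x ∂μ) ^ 2 ≤ (∫⁻ x, f x ^ 2 ∂μ) * ∫⁻ x, g x ^ 2 ∂μ := by
  have h := ENNReal.lintegral_mul_le_Lp_mul_Lq μ Real.HolderConjugate.two_two hf hg
  simp only [Pi.mul_apply, ENNReal.rpow_ofNat] at h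
  calc _ ≤ ((∫⁻ x, f x ^ 2 ∂μ) ^ (1 / 2 : ℝ) * (∫⁻ x, g x ^ 2 ∂μ) ^ (1 / 2 : ℝ)) ^ 2 := by gcongr
    _ = _ := by
      rw [mul_pow, ← ENNReal.rpow_natCast, ← ENNReal.rpow_natCast, ← ENNReal.rpow_mul,
        ← ENNReal.rpow_mul]
      norm_num

/-- Schur's test in `ℝ≥0∞`: Cauchy–Schwarz for the measure `g(x, y) dy`, then Tonelli. -/
lemma SchurBound.lintegral_sq_le [SFinite μ] {q : α → ℝ} {g : α → α → ℝ} {M : ℝ≥0}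
    (h : SchurBound μ q g M) {φ : α → ℝ≥0∞} (hφ : AEMeasurable φ μ) :
    ∫⁻ x, (∫⁻ y, ENNReal.ofReal (q x * g x y * q y) * φ y ∂μ) ^ 2 ∂μ ≤
      (M : ℝ≥0∞) ^ 2 * ∫⁻ y, φ y ^ 2 ∂μ := by
  have hq := h.measurable_weight
  have hg := h.measurable_kernel
  have hgx : ∀ x, Measurable (g x) := fun x => hg.of_uncurry_left
  have hpt : ∀ x, (∫⁻ y, ENNReal.ofReal (q x * g x y * q y) * φ y ∂μ) ^ 2 ≤
      M * ∫⁻ y, ENNReal.ofReal (g x y * q x ^ 2) * φ y ^ 2 ∂μ := fun x => by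
    have h1 : ∀ y, ENNReal.ofReal (q x * g x y * q y) * φ y =
        ENNReal.ofReal (√(g x y) * q y) * (ENNReal.ofReal (√(g x y) * q x) * φ y) := fun y => by
      rw [← mul_assoc, ← ENNReal.ofReal_mul (mul_nonneg (Real.sqrt_nonneg _) (h.weight_nonneg _))]
      congr 2
      calc q x * g x y * q y = q x * (√(g x y) * √(g x y)) * q y := by
            rw [Real.mul_self_sqrt (h.kernel_nonneg x y)]
        _ = _ := by ring
    have h2 : ∀ y t, 0 ≤ t → ENNReal.ofReal (√(g x y) * t) ^ 2 = ENNReal.ofReal (g x y * t ^ 2) :=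
      fun y t ht => by
        rw [← ENNReal.ofReal_pow (mul_nonneg (Real.sqrt_nonneg _) ht), mul_pow,
          Real.sq_sqrt (h.kernel_nonneg x y)]
    simp_rw [h1]
    refine (sq_lintegral_mul_le (by fun_prop) (by fun_prop)).trans ?_
    simp_rw [mul_pow, h2 _ _ (h.weight_nonneg _)]
    gcongr
    exact h.lintegral_le x
  calc _ ≤ ∫⁻ x, M * ∫⁻ y, ENNReal.ofReal (g x y * q x ^ 2) * φ y ^ 2 ∂μ ∂μ := lintegral_mono hpt
    _ = M * ∫⁻ y, ∫⁻ x, ENNReal.ofReal (g x y * q x ^ 2) * φ y ^ 2 ∂μ ∂μ := by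
      rw [lintegral_const_mul' _ _ (by simp), lintegral_lintegral_swap]
      have : Measurable fun p : α × α => ENNReal.ofReal (g p.1 p.2 * q p.1 ^ 2) :=
        (hg.mul ((hq.comp measurable_fst).pow_const 2)).ennreal_ofReal
      exact this.aemeasurable.mul ((hφ.comp_snd).pow_const 2)
    _ ≤ M * ∫⁻ y, M * φ y ^ 2 ∂μ := by
      gcongr with y
      rw [lintegral_mul_const'' _ (by
        simp_rw [h.symm _ y]; fun_prop)]
      gcongr
      simp_rw [h.symm _ y]
      exact h.lintegral_le y
    _ = _ := by rw [lintegral_const_mul' _ _ (by simp), ← mul_assoc, pow_two]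

lemma HasKernel.unique {T T' : Lp ℂ 2 μ →L[ℂ] Lp ℂ 2 μ} {k : α → α → ℂ} (h : HasKernel T k)
    (h' : HasKernel T' k) : T = T' :=
  ContinuousLinearMap.ext fun f => Lp.ext ((h f).2.trans (h' f).2.symm)

lemma HasKernel.sub {T T' : Lp ℂ 2 μ →L[ℂ] Lp ℂ 2 μ} {k k' : α → α → ℂ} (h : HasKernel T k)
    (h' : HasKernel T' k') : HasKernel (T - T') fun x y => k x y - k' x y := fun f => by
  refine ⟨?_, ?_⟩
  · filter_upwards [(h f).1, (h' f).1] with x h1 h2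
    simp only [sub_mul]
    exact h1.sub h2
  · rw [_root_.sub_apply]
    filter_upwards [(h f).1, (h' f).1, (h f).2, (h' f).2, Lp.coeFn_sub (T f) (T' f)]
      with x h1 h2 h3 h4 h5
    rw [h5, Pi.sub_apply, h3, h4, ← integral_sub h1 h2]
    simp only [sub_mul]

lemma HasKernel.const_smul {T : Lp ℂ 2 μ →L[ℂ] Lp ℂ 2 μ} {k : α → α → ℂ} (h : HasKernel T k)
    (c : ℂ) : HasKernel (c • T) fun x y => c * k x y := fun f => by
  refine ⟨?_, ?_⟩
  · filter_upwards [(h f).1] with x h1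
    simpa only [mul_assoc] using h1.const_mul c
  · rw [_root_.smul_apply]
    filter_upwards [(h f).2, Lp.coeFn_smul c (T f)] with x h3 h5
    rw [h5, Pi.smul_apply, h3, smul_eq_mul, ← integral_const_mul]
    simp only [mul_assoc]

section Schur

variable [SFinite μ] {q : α → ℝ} {g : α → α → ℝ} {M : ℝ≥0} {k : α → α → ℂ}

lemma SchurBound.ae_lintegral_lt_top (h : SchurBound μ q g M) (f : Lp ℂ 2 μ) :
    ∀ᵐ x ∂μ, ∫⁻ y, ENNReal.ofReal (q x * g x y * q y) * ‖f y‖ₑ ∂μ < ∞ := by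
  have hq := h.measurable_weight
  have hg := h.measurable_kernel
  have hf : AEMeasurable (fun y => ‖f y‖ₑ) μ := (Lp.aestronglyMeasurable f).enorm
  have hm : AEMeasurable (fun p : α × α => ENNReal.ofReal (q p.1 * g p.1 p.2 * q p.2) * ‖f p.2‖ₑ)
      (μ.prod μ) := by
    have : Measurable fun p : α × α => ENNReal.ofReal (q p.1 * g p.1 p.2 * q p.2) :=
      (((hq.comp measurable_fst).mul hg).mul (hq.comp measurable_snd)).ennreal_ofReal
    exact this.aemeasurable.mul hf.comp_snd
  have hF := hm.lintegral_prod_right'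
  have h1 := h.lintegral_sq_le hf
  rw [lintegral_sq_enorm_Lp] at h1
  have h2 := ae_lt_top' (hF.pow_const 2) (h1.trans_lt (by finiteness)).ne
  filter_upwards [h2] with x hx
  simpa using hx

/-- A kernel satisfying the Schur test defines a bounded operator on `L²`. -/
theorem SchurBound.exists_hasKernel (h : SchurBound μ q g M)
    (hk : Measurable (Function.uncurry k)) (hle : ∀ x y, ‖k x y‖ ≤ q x * g x y * q y) :
    ∃ T : Lp ℂ 2 μ →L[ℂ] Lp ℂ 2 μ, HasKernel T k ∧ ‖T‖ ≤ M := by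
  have hint : ∀ f : Lp ℂ 2 μ, ∀ᵐ x ∂μ, Integrable (fun y => k x y * f y) μ := fun f => by
    filter_upwards [h.ae_lintegral_lt_top f] with x hx
    refine ⟨(hk.of_uncurry_left.aestronglyMeasurable).mul (Lp.aestronglyMeasurable f), ?_⟩
    exact (lintegral_mono fun y => enorm_mul_le_of_norm_le hle f x y).trans_lt hx
  have hnorm : ∀ f : Lp ℂ 2 μ,
      eLpNorm (fun x => ∫ y, k x y * f y ∂μ) 2 μ ≤ ENNReal.ofReal (M * ‖f‖) := fun f => by
    have hf : AEMeasurable (fun y => ‖f y‖ₑ) μ := (Lp.aestronglyMeasurable f).enorm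
    rw [eLpNorm_two_eq]
    have h1 : ∫⁻ x, ‖∫ y, k x y * f y ∂μ‖ₑ ^ 2 ∂μ ≤ ENNReal.ofReal (M * ‖f‖) ^ 2 := by
      calc _ ≤ ∫⁻ x, (∫⁻ y, ENNReal.ofReal (q x * g x y * q y) * ‖f y‖ₑ ∂μ) ^ 2 ∂μ := by
            gcongr with x
            exact (enorm_integral_le_lintegral_enorm _).trans
              (lintegral_mono fun y => enorm_mul_le_of_norm_le hle f x y)
        _ ≤ _ := by
          refine (h.lintegral_sq_le hf).trans_eq ?_
          rw [lintegral_sq_enorm_Lp, ENNReal.ofReal_mul (NNReal.coe_nonneg M), mul_pow,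
            ENNReal.ofReal_pow (norm_nonneg f)]
          simp
    calc _ ≤ (ENNReal.ofReal (M * ‖f‖) ^ 2) ^ (1 / 2 : ℝ) := by gcongr
      _ = _ := by
        rw [← ENNReal.rpow_natCast, ← ENNReal.rpow_mul]
        norm_num
  have hmem : ∀ f : Lp ℂ 2 μ, MemLp (fun x => ∫ y, k x y * f y ∂μ) 2 μ := fun f => by
    refine ⟨?_, (hnorm f).trans_lt ENNReal.ofReal_lt_top⟩
    have : AEStronglyMeasurable (fun p : α × α => k p.1 p.2 * f p.2) (μ.prod μ) :=
      hk.aestronglyMeasurable.mul (Lp.aestronglyMeasurable f).comp_snd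
    exact this.integral_prod_right'
  let L : Lp ℂ 2 μ →ₗ[ℂ] Lp ℂ 2 μ :=
    { toFun := fun f => (hmem f).toLp _
      map_add' := fun f₁ f₂ => by
        rw [← MemLp.toLp_add]
        refine MemLp.toLp_congr _ _ ?_
        filter_upwards [hint f₁, hint f₂] with x h1 h2
        rw [Pi.add_apply, ← integral_add h1 h2]
        refine integral_congr_ae ?_
        filter_upwards [Lp.coeFn_add f₁ f₂] with y hy
        rw [hy, Pi.add_apply, mul_add]
      map_smul' := fun c f => by
        rw [RingHom.id_apply, ← MemLp.toLp_const_smul]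
        refine MemLp.toLp_congr _ _ (Eventually.of_forall fun x => ?_)
        rw [Pi.smul_apply, smul_eq_mul, ← integral_const_mul]
        refine integral_congr_ae ?_
        filter_upwards [Lp.coeFn_smul c f] with y hy
        rw [hy, Pi.smul_apply, smul_eq_mul]
        ring }
  have hL : ∀ f, ‖L f‖ ≤ M * ‖f‖ := fun f => by
    change ‖(hmem f).toLp _‖ ≤ _
    rw [Lp.norm_toLp]
    exact ENNReal.toReal_le_of_le_ofReal (by positivity) (hnorm f)
  exact ⟨L.mkContinuous M hL, fun f => ⟨hint f, (hmem f).coeFn_toLp⟩,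
    LinearMap.mkContinuous_norm_le _ M.2 _⟩

lemma SchurBound.norm_le_of_hasKernel (h : SchurBound μ q g M)
    (hk : Measurable (Function.uncurry k)) (hle : ∀ x y, ‖k x y‖ ≤ q x * g x y * q y)
    {T : Lp ℂ 2 μ →L[ℂ] Lp ℂ 2 μ} (hT : HasKernel T k) : ‖T‖ ≤ M := by
  obtain ⟨T', hT', hn⟩ := h.exists_hasKernel hk hle
  rwa [hT.unique hT']

/-- An integral operator with symmetric kernel is symmetric for the bilinear pairing `∫ u v`. -/
lemma SchurBound.integral_mul_comm (h : SchurBound μ q g M)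
    (hk : Measurable (Function.uncurry k)) (hle : ∀ x y, ‖k x y‖ ≤ q x * g x y * q y)
    (hsymm : ∀ x y, k x y = k y x) {T : Lp ℂ 2 μ →L[ℂ] Lp ℂ 2 μ} (hT : HasKernel T k)
    (f₁ f₂ : Lp ℂ 2 μ) : ∫ x, T f₁ x * f₂ x ∂μ = ∫ x, f₁ x * T f₂ x ∂μ := by
  have hq := h.measurable_weight
  have hg := h.measurable_kernel
  have hint : Integrable (fun p : α × α => k p.1 p.2 * f₁ p.2 * f₂ p.1) (μ.prod μ) := by
    have hf : AEMeasurable (fun y => ‖f₁ y‖ₑ) μ := (Lp.aestronglyMeasurable f₁).enorm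
    have hf₂ : AEMeasurable (fun y => ‖f₂ y‖ₑ) μ := (Lp.aestronglyMeasurable f₂).enorm
    have hm : AEMeasurable
        (fun p : α × α => ENNReal.ofReal (q p.1 * g p.1 p.2 * q p.2) * ‖f₁ p.2‖ₑ)
        (μ.prod μ) := by
      have : Measurable fun p : α × α => ENNReal.ofReal (q p.1 * g p.1 p.2 * q p.2) :=
        (((hq.comp measurable_fst).mul hg).mul (hq.comp measurable_snd)).ennreal_ofReal
      exact this.aemeasurable.mul hf.comp_snd
    have hms : AEStronglyMeasurable (fun p : α × α => k p.1 p.2 * f₁ p.2 * f₂ p.1) (μ.prod μ) :=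
      (hk.aestronglyMeasurable.mul (Lp.aestronglyMeasurable f₁).comp_snd).mul
        (Lp.aestronglyMeasurable f₂).comp_fst
    refine ⟨hms, ?_⟩
    rw [HasFiniteIntegral]
    calc _ ≤ ∫⁻ p : α × α, ENNReal.ofReal (q p.1 * g p.1 p.2 * q p.2) * ‖f₁ p.2‖ₑ * ‖f₂ p.1‖ₑ
          ∂(μ.prod μ) := by
          gcongr with p
          rw [enorm_mul]
          gcongr
          exact enorm_mul_le_of_norm_le hle f₁ p.1 p.2
      _ = ∫⁻ x, (∫⁻ y, ENNReal.ofReal (q x * g x y * q y) * ‖f₁ y‖ₑ ∂μ) * ‖f₂ x‖ₑ ∂μ := by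
          refine (lintegral_prod (fun p : α × α =>
            ENNReal.ofReal (q p.1 * g p.1 p.2 * q p.2) * ‖f₁ p.2‖ₑ * ‖f₂ p.1‖ₑ)
            (hm.mul hf₂.comp_fst)).trans (lintegral_congr fun x => ?_)
          exact lintegral_mul_const' ‖f₂ x‖ₑ _ enorm_ne_top
      _ < ∞ := by
        have h3 := sq_lintegral_mul_le hm.lintegral_prod_right' hf₂
        have h4 := h.lintegral_sq_le hf
        rw [lintegral_sq_enorm_Lp] at h3 h4
        have h5 : (∫⁻ x, (∫⁻ y, ENNReal.ofReal (q x * g x y * q y) * ‖f₁ y‖ₑ ∂μ) *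
            ‖f₂ x‖ₑ ∂μ) ^ 2 < ∞ :=
          h3.trans_lt (ENNReal.mul_lt_top (h4.trans_lt (by finiteness)) (by finiteness))
        simpa using h5
  calc ∫ x, T f₁ x * f₂ x ∂μ = ∫ x, ∫ y, k x y * f₁ y * f₂ x ∂μ ∂μ := by
        refine integral_congr_ae ?_
        filter_upwards [(hT f₁).2] with x hx
        rw [hx, integral_mul_const]
    _ = ∫ y, ∫ x, k x y * f₁ y * f₂ x ∂μ ∂μ := integral_integral_swap hint
    _ = ∫ x, f₁ x * T f₂ x ∂μ := by
        refine integral_congr_ae ?_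
        filter_upwards [(hT f₂).2] with y hy
        rw [hy, ← integral_const_mul]
        refine integral_congr_ae (Eventually.of_forall fun x => ?_)
        simp only [hsymm x y]
        ring

end Schur

end IntegralOperators

/-! ### Hilbert–Schmidt operators -/

section Compactness

/-- An operator on a Hilbert space whose values on a Hilbert basis are square summable is
compact: it is the norm limit of its restrictions to finitely many basis vectors. -/
lemma isCompactOperator_of_summable_sq {H ι : Type*} [NormedAddCommGroup H]
    [InnerProductSpace ℂ H] [CompleteSpace H] (b : HilbertBasis ι ℂ H) (T : H →L[ℂ] H)
    (hT : Summable fun i => ‖T (b i)‖ ^ 2) : IsCompactOperator T := by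
  set F : Finset ι → H →L[ℂ] H := fun s => ∑ i ∈ s, (innerSL ℂ (b i)).smulRight (T (b i)) with hF
  have hbound : ∀ s f, ‖(T - F s) f‖ ≤ √(∑' i : {i // i ∉ s}, ‖T (b i)‖ ^ 2) * ‖f‖ := fun s f => by
    have h1 : HasSum (fun i => inner ℂ (b i) f • T (b i)) (T f) := by
      have := (b.hasSum_repr f).mapL T
      simpa [b.repr_apply_apply] using this
    have h2 : HasSum (fun i : {i // i ∉ s} => inner ℂ (b i) f • T (b i)) ((T - F s) f) := by
      have h3 := (Finset.hasSum_compl_iff (f := fun i => inner ℂ (b i) f • T (b i))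
        (a := (T - F s) f) s).mpr
      apply h3
      convert h1 using 1
      simp [hF]
    refine le_of_tendsto h2.norm (Eventually.of_forall fun t => ?_)
    calc ‖∑ i ∈ t, inner ℂ (b i) f • T (b i)‖ ≤ ∑ i ∈ t, ‖T (b i)‖ * ‖inner ℂ (b i) f‖ := by
          refine (norm_sum_le _ _).trans_eq (Finset.sum_congr rfl fun i _ => ?_)
          rw [norm_smul, mul_comm]
      _ ≤ √(∑ i ∈ t, ‖T (b i)‖ ^ 2) * √(∑ i ∈ t, ‖inner ℂ (b i) f‖ ^ 2) :=
          Real.sum_mul_le_sqrt_mul_sqrt _ _ _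
      _ ≤ _ := by
          gcongr
          · exact (hT.subtype _).sum_le_tsum t (fun i _ => sq_nonneg _)
          · refine Real.sqrt_le_iff.mpr ⟨norm_nonneg f, ?_⟩
            have h4 : Orthonormal ℂ fun i : {i // i ∉ s} => b i :=
              b.orthonormal.comp _ Subtype.val_injective
            exact h4.sum_inner_products_le f
  have htend : Tendsto F atTop (𝓝 T) := by
    rw [tendsto_iff_norm_sub_tendsto_zero]
    have h1 : Tendsto (fun s : Finset ι => √(∑' i : {i // i ∉ s}, ‖T (b i)‖ ^ 2)) atTop (𝓝 0) := by
      have := (Real.continuous_sqrt.tendsto 0).comp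
        (tendsto_tsum_compl_atTop_zero fun i => ‖T (b i)‖ ^ 2)
      simpa [Function.comp_def] using this
    refine squeeze_zero (fun _ => norm_nonneg _) (fun s => ?_) h1
    rw [norm_sub_rev]
    exact ContinuousLinearMap.opNorm_le_bound _ (Real.sqrt_nonneg _) (hbound s)
  refine isCompactOperator_of_tendsto htend (Eventually.of_forall fun s => ?_)
  have h5 : ∀ i, IsCompactOperator ((innerSL ℂ (b i)).smulRight (T (b i))) := fun i =>
    (isCompactOperator_of_locallyCompactSpace_dom (innerSL ℂ (b i))).clm_comp
      (ContinuousLinearMap.toSpanSingleton ℂ (T (b i)))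
  have h6 : ∀ s, F s ∈ compactOperator (RingHom.id ℂ) H H := fun s =>
    Submodule.sum_mem _ fun i _ => h5 i
  exact h6 s

variable {α : Type*} [MeasurableSpace α] {μ : Measure α} [SFinite μ]

/-- Hilbert–Schmidt operators are compact. -/
theorem HasKernel.isCompactOperator {T : Lp ℂ 2 μ →L[ℂ] Lp ℂ 2 μ} {k : α → α → ℂ}
    (hT : HasKernel T k) (hk : Measurable (Function.uncurry k))
    (hfin : ∫⁻ x, ∫⁻ y, ‖k x y‖ₑ ^ 2 ∂μ ∂μ < ∞) : IsCompactOperator T := by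
  obtain ⟨w, b, -⟩ := exists_hilbertBasis ℂ (Lp ℂ 2 μ)
  refine isCompactOperator_of_summable_sq b T ?_
  refine summable_of_sum_le (fun _ => sq_nonneg _)
    (c := (∫⁻ x, ∫⁻ y, ‖k x y‖ₑ ^ 2 ∂μ ∂μ).toReal) fun s => ?_
  have hm : Measurable fun x => ∫⁻ y, ‖k x y‖ₑ ^ 2 ∂μ :=
    Measurable.lintegral_prod_right' (f := fun p : α × α => ‖k p.1 p.2‖ₑ ^ 2)
      (hk.enorm.pow_const 2)
  have hpt : ∀ᵐ x ∂μ, ∑ i ∈ s, ‖T (b i) x‖ₑ ^ 2 ≤ ∫⁻ y, ‖k x y‖ₑ ^ 2 ∂μ := by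
    have h1 : ∀ᵐ x ∂μ, ∀ i ∈ s, T (b i) x = ∫ y, k x y * b i y ∂μ := by
      exact (ae_ball_iff (s.countable_toSet)).mpr fun i _ => (hT (b i)).2
    filter_upwards [h1, ae_lt_top hm hfin.ne] with x hx hlt
    -- Bessel's inequality for the conjugate of the row `k(x, ·)`
    have hrow : MemLp (fun y => star (k x y)) 2 μ := by
      refine MemLp.star ⟨hk.of_uncurry_left.aestronglyMeasurable, ?_⟩
      rw [eLpNorm_two_eq]
      exact ENNReal.rpow_lt_top_of_nonneg (by norm_num) hlt.ne
    have h2 : ∀ i ∈ s, T (b i) x = inner ℂ (hrow.toLp _) (b i) := fun i hi => by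
      rw [hx i hi, L2.inner_def]
      refine integral_congr_ae ?_
      filter_upwards [hrow.coeFn_toLp] with y hy
      rw [hy]
      simp [mul_comm]
    have h3 := b.orthonormal.sum_inner_products_le (hrow.toLp _) (s := s)
    have h4 : ∑ i ∈ s, ‖T (b i) x‖ ^ 2 ≤ ‖hrow.toLp _‖ ^ 2 := by
      refine le_trans (le_of_eq (Finset.sum_congr rfl fun i hi => ?_)) h3
      rw [h2 i hi, norm_inner_symm]
    calc ∑ i ∈ s, ‖T (b i) x‖ₑ ^ 2 = ENNReal.ofReal (∑ i ∈ s, ‖T (b i) x‖ ^ 2) := by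
          rw [ENNReal.ofReal_sum_of_nonneg fun _ _ => sq_nonneg _]
          refine Finset.sum_congr rfl fun i _ => ?_
          rw [ENNReal.ofReal_pow (norm_nonneg _), ofReal_norm]
      _ ≤ ENNReal.ofReal (‖hrow.toLp _‖ ^ 2) := ENNReal.ofReal_le_ofReal h4
      _ = ∫⁻ y, ‖k x y‖ₑ ^ 2 ∂μ := by
          rw [← lintegral_sq_enorm_Lp]
          refine lintegral_congr_ae ?_
          filter_upwards [hrow.coeFn_toLp] with y hy
          rw [hy, ← ofReal_norm, norm_star, ofReal_norm]
  rw [← ENNReal.ofReal_le_iff_le_toReal hfin.ne,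
    ENNReal.ofReal_sum_of_nonneg fun _ _ => sq_nonneg _]
  simp_rw [← lintegral_sq_enorm_Lp]
  rw [← lintegral_finsetSum' _ fun i _ => (Lp.aestronglyMeasurable (T (b i))).enorm.pow_const 2]
  exact lintegral_mono_ae hpt

end Compactness

/-! ### Holomorphic families of integral operators -/

section Holomorphy

/-- Second-order Taylor estimate for a bounded holomorphic function on a disc. -/
lemma norm_sub_sub_mul_deriv_le {f : ℂ → ℂ} {c z : ℂ} {ρ B : ℝ}
    (hf : DifferentiableOn ℂ f (Metric.ball c ρ)) (hB : ∀ w ∈ Metric.ball c ρ, ‖f w‖ ≤ B)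
    (hz : z ∈ Metric.ball c ρ) :
    ‖f z - f c - (z - c) * deriv f c‖ ≤ 4 * B / ρ ^ 2 * ‖z - c‖ ^ 2 := by
  have hρ : 0 < ρ := Metric.pos_of_mem_ball hz
  have hc : c ∈ Metric.ball c ρ := Metric.mem_ball_self hρ
  have h1 : ∀ w ∈ Metric.ball c ρ, ‖dslope f c w‖ ≤ 2 * B / ρ := fun w hw => by
    refine Complex.norm_dslope_le_div_of_mapsTo_ball hf (fun u hu => ?_) hw
    rw [mem_closedBall_iff_norm]
    linarith [norm_sub_le (f u) (f c), hB u hu, hB c hc]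
  have h2 : DifferentiableOn ℂ (dslope f c) (Metric.ball c ρ) :=
    (Complex.differentiableOn_dslope (Metric.ball_mem_nhds c hρ)).mpr hf
  have h3 := Complex.dist_le_div_mul_dist_of_mapsTo_ball (R₂ := 2 * (2 * B / ρ)) h2 (fun u hu => by
    rw [mem_closedBall_iff_norm]
    linarith [norm_sub_le (dslope f c u) (dslope f c c), h1 u hu, h1 c hc]) hz
  rw [dist_eq_norm, dslope_same, dist_eq_norm] at h3
  have h4 : f z - f c - (z - c) * deriv f c = (z - c) * (dslope f c z - deriv f c) := by
    have := sub_smul_dslope f c z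
    rw [smul_eq_mul] at this
    rw [mul_sub, this]
  rw [h4, norm_mul]
  calc _ ≤ ‖z - c‖ * (2 * (2 * B / ρ) / ρ * ‖z - c‖) := by gcongr
    _ = _ := by field_simp; ring

lemma norm_deriv_le_of_ball {f : ℂ → ℂ} {c : ℂ} {ρ B : ℝ} (hρ : 0 < ρ)
    (hf : DifferentiableOn ℂ f (Metric.ball c ρ)) (hB : ∀ w ∈ Metric.ball c ρ, ‖f w‖ ≤ B) :
    ‖deriv f c‖ ≤ 2 * B / ρ := by
  have hc : c ∈ Metric.ball c ρ := Metric.mem_ball_self hρ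
  rw [← dslope_same]
  refine Complex.norm_dslope_le_div_of_mapsTo_ball hf (fun u hu => ?_) hc
  rw [mem_closedBall_iff_norm]
  linarith [norm_sub_le (f u) (f c), hB u hu, hB c hc]

lemma measurable_deriv_of_measurable {β : Type*} [MeasurableSpace β] {F : ℂ → β → ℂ} {c : ℂ}
    {ρ : ℝ} (hρ : 0 < ρ) (hF : ∀ z ∈ Metric.ball c ρ, Measurable (F z))
    (hd : ∀ b, DifferentiableAt ℂ (fun z => F z b) c) :
    Measurable fun b => deriv (fun z => F z b) c := by
  obtain ⟨u, -, hu, hlim⟩ := exists_seq_strictAnti_tendsto' hρ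
  have hmem : ∀ n, c + (u n : ℂ) ∈ Metric.ball c ρ := fun n => by
    simpa [abs_of_pos (hu n).1] using (hu n).2
  refine measurable_of_tendsto_metrizable (f := fun n b => (u n : ℂ)⁻¹ * (F (c + u n) b - F c b))
    (fun n => ((hF _ (hmem n)).sub (hF c (Metric.mem_ball_self hρ))).const_mul _) ?_
  rw [tendsto_pi_nhds]
  intro b
  have h1 := hasDerivAt_iff_tendsto_slope_zero.mp (hd b).hasDerivAt
  have h2 : Tendsto (fun n => (u n : ℂ)) atTop (𝓝[≠] 0) := by
    refine tendsto_nhdsWithin_iff.mpr ⟨?_, Eventually.of_forall fun n => ?_⟩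
    · simpa [Function.comp_def] using (Complex.continuous_ofReal.tendsto 0).comp hlim
    · simpa using (hu n).1.ne'
  simpa [Function.comp_def] using h1.comp h2

variable {α : Type*} [MeasurableSpace α] {μ : Measure α} [SFinite μ] {q : α → ℝ}
  {g : α → α → ℝ} {M : ℝ≥0}

/-- A family of kernels which is pointwise holomorphic in `z` and satisfies one Schur test
uniformly in `z` defines a holomorphic family of operators, whose derivative is the integral
operator of the differentiated kernel. -/
theorem SchurBound.exists_holomorphic_family (h : SchurBound μ q g M) {c : ℂ} {ρ : ℝ}
    (hρ : 0 < ρ) {k : ℂ → α → α → ℂ}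
    (hk : ∀ z ∈ Metric.ball c ρ, Measurable (Function.uncurry (k z)))
    (hd : ∀ x y, DifferentiableOn ℂ (fun z => k z x y) (Metric.ball c ρ))
    (hle : ∀ z ∈ Metric.ball c ρ, ∀ x y, ‖k z x y‖ ≤ q x * g x y * q y) :
    ∃ K : ℂ → Lp ℂ 2 μ →L[ℂ] Lp ℂ 2 μ, (∀ z ∈ Metric.ball c ρ, HasKernel (K z) (k z)) ∧
      AnalyticAt ℂ K c ∧ HasKernel (deriv K c) fun x y => deriv (fun z => k z x y) c := by
  classical
  have hex : ∀ z ∈ Metric.ball c ρ, ∃ T : Lp ℂ 2 μ →L[ℂ] Lp ℂ 2 μ, HasKernel T (k z) := fun z hz =>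
    let ⟨T, hT, _⟩ := h.exists_hasKernel (hk z hz) (hle z hz)
    ⟨T, hT⟩
  set K : ℂ → Lp ℂ 2 μ →L[ℂ] Lp ℂ 2 μ := fun z =>
    if hz : z ∈ Metric.ball c ρ then (hex z hz).choose else 0 with hKdef
  have hK : ∀ z ∈ Metric.ball c ρ, HasKernel (K z) (k z) := fun z hz => by
    rw [hKdef]
    simp only [hz, dif_pos]
    exact (hex z hz).choose_spec
  have hderiv : ∀ w ∈ Metric.ball c ρ, ∃ K' : Lp ℂ 2 μ →L[ℂ] Lp ℂ 2 μ, HasDerivAt K K' w ∧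
      HasKernel K' fun x y => deriv (fun z => k z x y) w := by
    intro w hw
    obtain ⟨η, hη, hηsub⟩ := Metric.isOpen_iff.mp Metric.isOpen_ball w hw
    have hdw : ∀ x y, DifferentiableOn ℂ (fun z => k z x y) (Metric.ball w η) := fun x y =>
      (hd x y).mono hηsub
    have hmd : Measurable (Function.uncurry fun x y => deriv (fun z => k z x y) w) :=
      measurable_deriv_of_measurable (F := fun z (p : α × α) => k z p.1 p.2) hη
        (fun z hz => hk z (hηsub hz))
        fun p => (hdw p.1 p.2).differentiableAt (Metric.ball_mem_nhds w hη)
    obtain ⟨K', hK', -⟩ := (h.const_mul (2 / η).toNNReal).exists_hasKernel hmd fun x y => by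
      refine (norm_deriv_le_of_ball hη (hdw x y) fun z hz => hle z (hηsub hz) x y).trans_eq ?_
      rw [Real.coe_toNNReal _ (by positivity)]
      ring
    refine ⟨K', ?_, hK'⟩
    have hest : ∀ z ∈ Metric.ball w η,
        ‖K z - K w - (z - w) • K'‖ ≤ 4 / η ^ 2 * M * ‖z - w‖ ^ 2 := fun z hz => by
      have h1 := ((hK z (hηsub hz)).sub (hK w hw)).sub (hK'.const_smul (z - w))
      have hm : Measurable (Function.uncurry fun x y =>
          k z x y - k w x y - (z - w) * deriv (fun z => k z x y) w) :=
        ((hk z (hηsub hz)).sub (hk w hw)).sub (hmd.const_mul _)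
      refine ((h.const_mul (4 / η ^ 2 * ‖z - w‖ ^ 2).toNNReal).norm_le_of_hasKernel hm
        (fun x y => ?_) h1).trans_eq ?_
      · refine (norm_sub_sub_mul_deriv_le (hdw x y)
          (fun u hu => hle u (hηsub hu) x y) hz).trans_eq ?_
        rw [Real.coe_toNNReal _ (by positivity)]
        ring
      · rw [NNReal.coe_mul, Real.coe_toNNReal _ (by positivity)]
        ring
    rw [hasDerivAt_iff_isLittleO]
    have h2 : (fun z => K z - K w - (z - w) • K') =O[𝓝 w] fun z => ‖z - w‖ ^ 2 := by
      refine IsBigO.of_bound (4 / η ^ 2 * M) ?_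
      filter_upwards [Metric.ball_mem_nhds w hη] with z hz
      simpa using hest z hz
    refine h2.trans_isLittleO ?_
    have h3 := (isLittleO_norm_pow_id (E' := ℂ) one_lt_two)
    have h4 : Tendsto (fun z => z - w) (𝓝 w) (𝓝 0) := by
      have : Continuous fun z : ℂ => z - w := by fun_prop
      simpa using this.tendsto w
    exact h3.comp_tendsto h4
  have hKd : DifferentiableOn ℂ K (Metric.ball c ρ) := fun w hw =>
    (hderiv w hw).choose_spec.1.differentiableAt.differentiableWithinAt
  refine ⟨K, hK, hKd.analyticAt (Metric.ball_mem_nhds c hρ), ?_⟩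
  obtain ⟨K', h1, h2⟩ := hderiv c (Metric.mem_ball_self hρ)
  rwa [h1.deriv]

end Holomorphy

/-! ### First-order expansion of a branch of null vectors -/

section Perturbation

variable {E : Type*} [NormedAddCommGroup E] [NormedSpace ℂ E]

lemma isBigO_clm_apply {ι F G : Type*} [NormedAddCommGroup F] [NormedSpace ℂ F]
    [NormedAddCommGroup G] [NormedSpace ℂ G] {l : Filter ι} {A : ι → F →L[ℂ] G}
    {v : ι → F} {a b : ι → ℝ} (hA : A =O[l] a) (hv : v =O[l] b) :
    (fun i => A i (v i)) =O[l] fun i => a i * b i :=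
  (IsBigO.of_bound 1 (Eventually.of_forall fun i => by
    simpa using (A i).le_opNorm (v i))).trans (hA.norm_left.mul hv.norm_left)

lemma isBigO_sub_sub_smul_deriv {F : Type*} [NormedAddCommGroup F] [NormedSpace ℂ F]
    {f : ℂ → F} {z₀ : ℂ} (hf : AnalyticAt ℂ f z₀) :
    (fun z => f z - f z₀ - (z - z₀) • deriv f z₀) =O[𝓝 z₀] fun z => ‖z - z₀‖ ^ 2 := by
  obtain ⟨p, hp⟩ := hf
  have h := hp.isBigO_sub_partialSum_pow 2
  have ht : Tendsto (fun z => z - z₀) (𝓝 z₀) (𝓝 0) := by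
    have : Continuous fun z : ℂ => z - z₀ := by fun_prop
    simpa using this.tendsto z₀
  refine (h.comp_tendsto ht).congr_left fun z => ?_
  have h0 : p.coeff 0 = f z₀ := hp.coeff_zero _
  simp [FormalMultilinearSeries.partialSum, Finset.sum_range_succ, h0, hp.deriv, sub_sub]

/-- First-order expansion of the zero `z(ε)` of a branch of null vectors `f(ε)` of
`1 + K(z) (M₀ + ε M₁)`: testing the equation with a left null vector `φ` of `1 + K(z₀) M₀`
removes the zeroth-order term, and what is left is a linear equation for `z(ε) - z₀` up to
quadratic errors. -/
theorem isBigO_spectral_shift {K : ℂ → E →L[ℂ] E} {z₀ : ℂ} (hK : AnalyticAt ℂ K z₀)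
    (M₀ M₁ : E →L[ℂ] E) (φ : E →L[ℂ] ℂ) (hφ : ∀ f, φ (f + K z₀ (M₀ f)) = 0) (f₀ : E)
    (hden : φ (deriv K z₀ (M₀ f₀)) ≠ 0) {l : Filter ℝ} (hl : l ≤ 𝓝 0) {z : ℝ → ℂ} {f : ℝ → E}
    (hz : Tendsto z l (𝓝 z₀))
    (hf : (fun ε => f ε - f₀) =O[l] fun ε => |ε| + ‖z ε - z₀‖)
    (hN : ∀ᶠ ε in l, f ε + K (z ε) (M₀ (f ε) + (ε : ℂ) • M₁ (f ε)) = 0) :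
    (fun ε : ℝ => z ε - z₀ -
      (-φ (K z₀ (M₁ f₀)) / φ (deriv K z₀ (M₀ f₀))) * (ε : ℂ)) =O[l] fun ε => ε ^ 2 := by
  set D := φ (deriv K z₀ (M₀ f₀)) with hD
  set ν := -φ (K z₀ (M₁ f₀)) / D with hν
  set s : ℝ → ℝ := fun ε => |ε| + ‖z ε - z₀‖ with hs
  have hε0 : Tendsto (fun ε : ℝ => ε) l (𝓝 0) := hl
  have hzz : Tendsto (fun ε => ‖z ε - z₀‖) l (𝓝 0) := tendsto_iff_norm_sub_tendsto_zero.mp hz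
  have hs0 : Tendsto s l (𝓝 0) := by
    simpa [hs] using hε0.abs.add hzz
  have hsnn : ∀ ε, 0 ≤ s ε := fun ε => add_nonneg (abs_nonneg _) (norm_nonneg _)
  have hεs : (fun ε : ℝ => (ε : ℂ)) =O[l] s := by
    refine IsBigO.of_bound 1 (Eventually.of_forall fun ε => ?_)
    rw [one_mul, Real.norm_of_nonneg (hsnn ε), Complex.norm_real]; simp [hs]
  have hhs : (fun ε => z ε - z₀) =O[l] s := by
    refine IsBigO.of_bound 1 (Eventually.of_forall fun ε => ?_)
    rw [one_mul, Real.norm_of_nonneg (hsnn ε)]; simp [hs]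
  have hsone : s =O[l] fun _ => (1 : ℝ) := hs0.isBigO_one ℝ
  have hf1 : f =O[l] fun _ => (1 : ℝ) := by
    simpa using (hf.trans hsone).add (isBigO_const_const f₀ one_ne_zero l)
  have hK1 : (fun ε => K (z ε) - K z₀) =O[l] s :=
    ((hK.differentiableAt.hasDerivAt.isBigO_sub).comp_tendsto hz).trans hhs
  have hK2 : (fun ε => K (z ε) - K z₀ - (z ε - z₀) • deriv K z₀) =O[l] fun ε => s ε * s ε := by
    have := (isBigO_sub_sub_smul_deriv hK).comp_tendsto hz
    refine this.trans ?_
    simpa [Function.comp_def, pow_two] using hhs.norm_left.mul hhs.norm_left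
  have hop : ∀ (A : E →L[ℂ] E), (fun _ : ℝ => φ ∘L A) =O[l] fun _ => (1 : ℝ) := fun A =>
    isBigO_const_const _ one_ne_zero l
  have hMf : ∀ A : E →L[ℂ] E, (fun ε => A (f ε)) =O[l] fun _ => (1 : ℝ) := fun A => by
    simpa using isBigO_clm_apply (isBigO_const_const A (one_ne_zero (α := ℝ)) l) hf1
  have hφO : ∀ {v : ℝ → E} {b : ℝ → ℝ}, v =O[l] b → (fun ε => φ (v ε)) =O[l] b := fun hv => by
    simpa using isBigO_clm_apply (isBigO_const_const φ (one_ne_zero (α := ℝ)) l) hv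
  have hAO : ∀ (A : E →L[ℂ] E) {v : ℝ → E} {b : ℝ → ℝ}, v =O[l] b →
      (fun ε => A (v ε)) =O[l] b := fun A _ _ hv => by
    simpa using isBigO_clm_apply (isBigO_const_const A (one_ne_zero (α := ℝ)) l) hv
  -- the four quadratic error terms
  have R1 : (fun ε => (z ε - z₀) * φ (deriv K z₀ (M₀ (f ε - f₀)))) =O[l] fun ε => s ε * s ε :=
    hhs.mul (hφO (hAO _ (hAO _ hf)))
  have R2 : (fun ε => φ ((K (z ε) - K z₀ - (z ε - z₀) • deriv K z₀) (M₀ (f ε)))) =O[l]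
      fun ε => s ε * s ε := by
    simpa using hφO (isBigO_clm_apply hK2 (hMf M₀))
  have R3 : (fun ε : ℝ => (ε : ℂ) * φ ((K (z ε) - K z₀) (M₁ (f ε)))) =O[l] fun ε => s ε * s ε :=
    hεs.mul (by simpa using hφO (isBigO_clm_apply hK1 (hMf M₁)))
  have R4 : (fun ε : ℝ => (ε : ℂ) * φ (K z₀ (M₁ (f ε - f₀)))) =O[l] fun ε => s ε * s ε :=
    hεs.mul (hφO (hAO _ (hAO _ hf)))
  have hmain : (fun ε : ℝ => z ε - z₀ - ν * (ε : ℂ)) =O[l] fun ε => s ε * s ε := by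
    have hsum := (((R1.add R2).add R3).add R4).const_mul_left (-D⁻¹)
    refine hsum.congr' ?_ EventuallyEq.rfl
    filter_upwards [hN] with ε hε
    have h1 : φ (f ε) + φ (K (z ε) (M₀ (f ε))) + (ε : ℂ) * φ (K (z ε) (M₁ (f ε))) = 0 := by
      have := congrArg φ hε
      simpa [add_assoc] using this
    have h2 : φ (f ε) + φ (K z₀ (M₀ (f ε))) = 0 := by simpa using hφ (f ε)
    have h3 : ν * D = -φ (K z₀ (M₁ f₀)) := by rw [hν]; field_simp
    simp only [map_sub, _root_.sub_apply, _root_.smul_apply, map_smul,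
      smul_eq_mul]
    field_simp
    rw [← hD]
    linear_combination h2 - h1 + (ε : ℂ) * h3
  -- the shift is `O(ε)`, so the quadratic errors are `O(ε²)`
  have hlin : (fun ε => z ε - z₀) =O[l] fun ε : ℝ => ε := by
    have hsmall : (fun ε : ℝ => z ε - z₀ - ν * (ε : ℂ)) =o[l] s := by
      refine hmain.trans_isLittleO ?_
      have : s =o[l] fun _ => (1 : ℝ) := (isLittleO_one_iff ℝ).mpr hs0
      simpa using this.mul_isBigO (isBigO_refl s l)
    refine IsBigO.of_bound (2 * ‖ν‖ + 1) ?_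
    filter_upwards [hsmall.bound (show (0 : ℝ) < 1 / 2 by norm_num)] with ε hε
    rw [Real.norm_of_nonneg (hsnn ε)] at hε
    have h4 : ‖z ε - z₀‖ ≤ ‖z ε - z₀ - ν * (ε : ℂ)‖ + ‖ν * (ε : ℂ)‖ := by
      simpa using norm_add_le (z ε - z₀ - ν * (ε : ℂ)) (ν * (ε : ℂ))
    rw [norm_mul, Complex.norm_real, Real.norm_eq_abs] at h4
    rw [Real.norm_eq_abs]
    simp only [hs] at hε
    linarith
  have hsO : s =O[l] fun ε : ℝ => ε :=
    ((isBigO_refl (fun ε : ℝ => ε) l).norm_left).add hlin.norm_left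
  refine hmain.trans ?_
  simpa [pow_two] using hsO.mul hsO

end Perturbation

/-! ### Existence and uniqueness near a simple null vector -/

section Reduction

variable {E : Type*} [NormedAddCommGroup E] [NormedSpace ℂ E]

lemma isInvertible_of_apply_one_ne_zero (f : ℂ →L[ℂ] ℂ) (h : f 1 ≠ 0) : f.IsInvertible := by
  refine ⟨ContinuousLinearEquiv.unitsEquivAut ℂ (Units.mk0 _ h), ?_⟩
  ext
  simp

/-- Injectivity of a compact perturbation of the identity implies invertibility. -/
lemma isUnit_one_add_of_isCompactOperator [CompleteSpace E] {S : E →L[ℂ] E}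
    (hS : IsCompactOperator S) (hinj : ∀ f, f + S f = 0 → f = 0) : IsUnit (1 + S) := by
  have h := hS.hasEigenvalue_or_mem_resolventSet (μ := (-1 : ℂ)) (by simp)
  rcases h with h | h
  · obtain ⟨v, hv⟩ := h.exists_hasEigenvector
    refine absurd (hinj v ?_) hv.2
    have := hv.apply_eq_smul
    simp only [ContinuousLinearMap.coe_coe, neg_smul, one_smul] at this
    simp [this]
  · rw [spectrum.mem_resolventSet_iff] at h
    have := h.neg
    convert this using 1
    simp [add_comm]

lemma isCompactOperator_smulRight (l : E →L[ℂ] ℂ) (e : E) :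
    IsCompactOperator (l.smulRight e) :=
  (isCompactOperator_of_locallyCompactSpace_dom l).clm_comp
    (ContinuousLinearMap.toSpanSingleton ℂ e)

lemma hasDerivAt_apply_ringInverse_apply [CompleteSpace E] {T : ℂ → E →L[ℂ] E} {T' : E →L[ℂ] E}
    {z₀ : ℂ} (hT : HasDerivAt T T' z₀) (hU : IsUnit (T z₀)) (l : E →L[ℂ] ℂ) (e : E) :
    HasDerivAt (fun z => l (Ring.inverse (T z) e))
      (-l (Ring.inverse (T z₀) (T' (Ring.inverse (T z₀) e)))) z₀ := by
  obtain ⟨U, hU⟩ := hU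
  have h6 := hasFDerivAt_ringInverse (𝕜 := ℂ) U
  have h7 : (↑U⁻¹ : E →L[ℂ] E) = Ring.inverse (T z₀) := by rw [← hU, Ring.inverse_unit]
  rw [hU, h7] at h6
  have h8 := (h6.comp_hasDerivAt z₀ hT).clm_apply (hasDerivAt_const z₀ e)
  have h9 := l.hasFDerivAt.comp_hasDerivAt z₀ h8
  convert! h9 using 1
  simp [ContinuousLinearMap.mulLeftRight_apply]

/-- If `T` is invertible, then `T` minus the rank-one operator `l ⊗ e` has a null vector exactly
when `l (T⁻¹ e) = 1`. -/
lemma exists_ne_zero_apply_eq_iff {T : E →L[ℂ] E} (hT : IsUnit T) (l : E →L[ℂ] ℂ) (e : E) :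
    (∃ f ≠ 0, T f = l f • e) ↔ l (Ring.inverse T e) = 1 := by
  have h1 : ∀ f, Ring.inverse T (T f) = f := fun f => by
    simpa using congrArg (fun A : E →L[ℂ] E => A f) (Ring.inverse_mul_cancel T hT)
  have h2 : ∀ f, T (Ring.inverse T f) = f := fun f => by
    simpa using congrArg (fun A : E →L[ℂ] E => A f) (Ring.mul_inverse_cancel T hT)
  constructor
  · rintro ⟨f, hf, hTf⟩
    have h3 : f = l f • Ring.inverse T e := by
      have := h1 f
      rw [hTf, map_smul] at this
      exact this.symm
    have h4 : l f ≠ 0 := fun h0 => hf (by rw [h3, h0, zero_smul])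
    have h5 := congrArg l h3
    rw [map_smul, smul_eq_mul] at h5
    exact mul_left_cancel₀ h4 (by rw [← h5, mul_one])
  · intro h
    refine ⟨Ring.inverse T e, fun h0 => ?_, by rw [h2, h, one_smul]⟩
    rw [h0, map_zero] at h
    exact zero_ne_one h

/-- Perturbation of a simple null vector: if `1 + K(z₀) M₀` has a one-dimensional kernel spanned
by `f₀` and the zero is simple in `z`, then for small `ε` there is exactly one `z` near `z₀` for
which `1 + K(z) (M₀ + ε M₁)` has a kernel.

Adding a rank-one operator `l ⊗ e` makes the operator invertible at the base point (Fredholm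
alternative), hence nearby, and the kernel is nontrivial exactly at the zeros of the scalar
function `1 - l (T⁻¹ e)`, to which the implicit function theorem applies. -/
theorem exists_unique_spectral_shift [CompleteSpace E] {K : ℂ → E →L[ℂ] E} {z₀ : ℂ}
    (hK : AnalyticAt ℂ K z₀) (hKc : IsCompactOperator (K z₀)) (M₀ M₁ : E →L[ℂ] E)
    (φ : E →L[ℂ] ℂ) (hφ : ∀ f, φ (f + K z₀ (M₀ f)) = 0) (f₀ : E) (hf₀ : f₀ + K z₀ (M₀ f₀) = 0)
    (hker : ∀ f, f + K z₀ (M₀ f) = 0 → ∃ c : ℂ, f = c • f₀)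
    (hden : φ (deriv K z₀ (M₀ f₀)) ≠ 0) {r : ℝ} (hr : 0 < r) :
    ∃ δ > 0, δ ≤ r ∧ ∃ ε₀ > 0, ∃ C : ℝ, ∀ ε : ℝ, |ε| < ε₀ → ∃ z ∈ Metric.ball z₀ δ,
      (∃ f ≠ 0, f + K z (M₀ f + (ε : ℂ) • M₁ f) = 0) ∧
      (∀ w ∈ Metric.ball z₀ δ, (∃ f ≠ 0, f + K w (M₀ f + (ε : ℂ) • M₁ f) = 0) → w = z) ∧
      ‖z - z₀ - (-φ (K z₀ (M₁ f₀)) / φ (deriv K z₀ (M₀ f₀))) * (ε : ℂ)‖ ≤ C * ε ^ 2 := by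
  set D := φ (deriv K z₀ (M₀ f₀)) with hD
  have hf₀0 : f₀ ≠ 0 := by
    rintro rfl
    simp [hD] at hden
  obtain ⟨l, hl⟩ := SeparatingDual.exists_eq_one (R := ℂ) hf₀0
  set e : E := D⁻¹ • deriv K z₀ (M₀ f₀) with he
  have hφe : φ e = 1 := by rw [he, map_smul, ← hD, smul_eq_mul, inv_mul_cancel₀ hden]
  -- the family `T(ε, z)` of modified operators
  set T : ℂ × ℂ → E →L[ℂ] E := fun u => 1 + (K u.2 ∘L (M₀ + u.1 • M₁) + l.smulRight e) with hT
  have hTapp : ∀ u f, T u f = f + K u.2 (M₀ f + u.1 • M₁ f) + l f • e := fun u f => by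
    simp [hT, add_assoc]
  have hTunit : IsUnit (T (0, z₀)) := by
    refine isUnit_one_add_of_isCompactOperator ?_ fun f hf => ?_
    · exact ((hKc.comp_clm (M₀ + (0 : ℂ) • M₁)).add (isCompactOperator_smulRight l e))
    · have hf' : f + K z₀ (M₀ f) + l f • e = 0 := by simpa [add_assoc] using hf
      have h1 : l f = 0 := by
        have := congrArg φ hf'
        rw [map_add, hφ, map_smul, hφe] at this
        simpa using this
      obtain ⟨c, rfl⟩ := hker f (by simpa [h1] using hf')
      have : c = 0 := by simpa [hl] using h1
      simp [this]
  have hTC : ContDiffAt ℂ 1 T (0, z₀) := by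
    have h1 : ContDiffAt ℂ 1 (fun u : ℂ × ℂ => K u.2) (0, z₀) :=
      ContDiffAt.comp (0, z₀) (f := Prod.snd) (hK.contDiffAt) contDiffAt_snd
    have h2 : ContDiffAt ℂ 1 (fun u : ℂ × ℂ => M₀ + u.1 • M₁) (0, z₀) := by fun_prop
    exact contDiffAt_const.add ((h1.clm_comp h2).add contDiffAt_const)
  set R : ℂ × ℂ → E →L[ℂ] E := fun u => Ring.inverse (T u) with hR
  have hRC : ContDiffAt ℂ 1 R (0, z₀) := by
    obtain ⟨U, hU⟩ := hTunit
    have := contDiffAt_ringInverse ℂ (n := 1) U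
    rw [hU] at this
    exact this.comp (0, z₀) hTC
  set F : ℂ × ℂ → ℂ := fun u => l (R u e) with hF
  have hReC : ContDiffAt ℂ 1 (fun u => R u e) (0, z₀) := hRC.clm_apply contDiffAt_const
  have hFC : ContDiffAt ℂ 1 F (0, z₀) := l.contDiff.contDiffAt.comp (0, z₀) hReC
  have hRe : R (0, z₀) e = f₀ := by
    have h1 : T (0, z₀) f₀ = e := by rw [hTapp]; simp [hf₀, hl]
    have := congrArg (fun A : E →L[ℂ] E => A f₀) (Ring.inverse_mul_cancel _ hTunit)
    simpa [h1] using this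
  have hF0 : F (0, z₀) = 1 := by simp only [hF]; rw [hRe, hl]
  -- the left null vector is `φ = l ∘ T⁻¹`, so the `z`-derivative of `F` is `-D`
  have hlR : ∀ v, l (R (0, z₀) v) = φ v := fun v => by
    have h1 : ∀ f, φ (T (0, z₀) f) = l f := fun f => by
      rw [hTapp, map_add, map_smul, hφe]
      have := hφ f
      simp only [zero_smul, add_zero, smul_eq_mul, mul_one]
      rw [this, zero_add]
    have h2 : T (0, z₀) (R (0, z₀) v) = v := by
      simpa using congrArg (fun A : E →L[ℂ] E => A v) (Ring.mul_inverse_cancel _ hTunit)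
    rw [← h1, h2]
  have hderiv : (fderiv ℂ F (0, z₀) ∘L .inr ℂ ℂ ℂ) 1 = -D := by
    have h1 : HasDerivAt (fun z : ℂ => F (0, z)) (fderiv ℂ F (0, z₀) (0, 1)) z₀ := by
      have h2 := (hFC.differentiableAt one_ne_zero).hasFDerivAt
      have h3 : HasDerivAt (fun z : ℂ => ((0 : ℂ), z)) (0, 1) z₀ :=
        (hasDerivAt_const _ _).prodMk (hasDerivAt_id _)
      exact h2.comp_hasDerivAt z₀ h3
    have h4 : HasDerivAt (fun z : ℂ => F (0, z)) (-D) z₀ := by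
      have hTd : HasDerivAt (fun z : ℂ => T (0, z)) (deriv K z₀ ∘L M₀) z₀ := by
        have h5 := hK.differentiableAt.hasDerivAt.clm_comp (hasDerivAt_const z₀ M₀)
        simpa [hT] using (h5.add_const (l.smulRight e)).const_add 1
      have h6 := hasDerivAt_apply_ringInverse_apply hTd hTunit l e
      have h7 : l (R (0, z₀) ((deriv K z₀ ∘L M₀) (R (0, z₀) e))) = D := by
        rw [hlR, hRe, hD]; rfl
      rw [← h7]
      exact h6
    simpa using h1.unique h4
  have hinv : (fderiv ℂ F (0, z₀) ∘L .inr ℂ ℂ ℂ).IsInvertible :=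
    isInvertible_of_apply_one_ne_zero _ (by rw [hderiv]; exact neg_ne_zero.mpr hden)
  set ψ := hFC.implicitFunction one_ne_zero hinv with hψ
  have hψC : ContDiffAt ℂ 1 ψ 0 := hFC.contDiffAt_implicitFunction one_ne_zero hinv
  have hψ0 : ψ 0 = z₀ := hFC.implicitFunction_apply_self one_ne_zero hinv
  have hiff : ∀ᶠ u : ℂ × ℂ in 𝓝 (0, z₀),
      ((∃ f ≠ 0, f + K u.2 (M₀ f + u.1 • M₁ f) = 0) ↔ ψ u.1 = u.2) := by
    have hunit : ∀ᶠ u in 𝓝 ((0 : ℂ), z₀), IsUnit (T u) :=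
      hTC.continuousAt.eventually (Units.isOpen.mem_nhds hTunit)
    filter_upwards [hFC.eventually_apply_eq_iff_implicitFunction one_ne_zero hinv, hunit]
      with u hu1 hu2
    rw [← hψ, hF0] at hu1
    rw [← hu1, hF]
    refine Iff.trans ?_ (exists_ne_zero_apply_eq_iff hu2 l e)
    simp only [hTapp, add_eq_right]
  obtain ⟨η, hη, hball⟩ := Metric.eventually_nhds_iff_ball.mp hiff
  set δ := min η r with hδ
  have hδ0 : 0 < δ := lt_min hη hr
  have hψr : Tendsto (fun ε : ℝ => ψ (ε : ℂ)) (𝓝 0) (𝓝 z₀) := by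
    have h1 : Tendsto (fun ε : ℝ => (ε : ℂ)) (𝓝 0) (𝓝 0) := by
      simpa using Complex.continuous_ofReal.tendsto 0
    have h2 := hψC.continuousAt.tendsto
    rw [hψ0] at h2
    exact h2.comp h1
  have hsol : ∀ᶠ ε : ℝ in 𝓝 0, ψ (ε : ℂ) ∈ Metric.ball z₀ δ ∧
      ((ε : ℂ), z₀) ∈ Metric.ball (0, z₀) η := by
    refine (hψr.eventually (Metric.ball_mem_nhds z₀ hδ0)).and ?_
    filter_upwards [Metric.ball_mem_nhds (0 : ℝ) hη] with ε hε
    simpa [Prod.dist_eq, hη] using hε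
  have hmem : ∀ {ε : ℝ} {w : ℂ}, ((ε : ℂ), z₀) ∈ Metric.ball ((0 : ℂ), z₀) η →
      w ∈ Metric.ball z₀ δ → ((ε : ℂ), w) ∈ Metric.ball ((0 : ℂ), z₀) η := by
    intro ε w h1 h2
    simp only [Metric.mem_ball, Prod.dist_eq, dist_self, max_lt_iff] at h1 h2 ⊢
    exact ⟨h1.1, h2.trans_le (min_le_left _ _)⟩
  -- the expansion, from the null vectors `T⁻¹ e`
  have hexp := isBigO_spectral_shift hK M₀ M₁ φ hφ f₀ hden le_rfl hψr
    (f := fun ε : ℝ => R ((ε : ℂ), ψ ε) e) (by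
      have h1 := (hReC.differentiableAt one_ne_zero).isBigO_sub
      have h2 : Tendsto (fun ε : ℝ => ((ε : ℂ), ψ ε)) (𝓝 0) (𝓝 (0, z₀)) := by
        rw [nhds_prod_eq]
        refine Tendsto.prodMk ?_ hψr
        simpa using Complex.continuous_ofReal.tendsto 0
      have h3 := h1.comp_tendsto h2
      rw [hRe] at h3
      refine h3.trans (IsBigO.of_bound 1 (Eventually.of_forall fun ε => ?_))
      have hn := norm_nonneg (ψ (ε : ℂ) - z₀)
      rw [one_mul, Real.norm_of_nonneg (by positivity)]
      simp only [Function.comp_apply, Prod.mk_sub_mk, sub_zero, Prod.norm_mk, Complex.norm_real,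
        Real.norm_eq_abs]
      exact max_le (by linarith) (by linarith [abs_nonneg ε])) (by
      have hunit : ∀ᶠ u in 𝓝 ((0 : ℂ), z₀), IsUnit (T u) :=
        hTC.continuousAt.eventually (Units.isOpen.mem_nhds hTunit)
      have h2 : Tendsto (fun ε : ℝ => ((ε : ℂ), ψ ε)) (𝓝 0) (𝓝 (0, z₀)) := by
        rw [nhds_prod_eq]
        refine Tendsto.prodMk ?_ hψr
        simpa using Complex.continuous_ofReal.tendsto 0
      filter_upwards [h2.eventually hunit,
        h2.eventually (hFC.eventually_apply_eq_iff_implicitFunction one_ne_zero hinv)] with ε h4 h5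
      have h6 : l (R ((ε : ℂ), ψ ε) e) = 1 := by rw [hF0] at h5; exact h5.mpr rfl
      have h7 : T ((ε : ℂ), ψ ε) (R ((ε : ℂ), ψ ε) e) = e := by
        simpa using congrArg (fun A : E →L[ℂ] E => A e) (Ring.mul_inverse_cancel _ h4)
      rw [hTapp, h6, one_smul, add_eq_right] at h7
      exact h7)
  obtain ⟨C, hC⟩ := hexp.bound
  obtain ⟨ε₀, hε₀, hev⟩ := Metric.eventually_nhds_iff_ball.mp (hsol.and hC)
  refine ⟨δ, hδ0, min_le_right _ _, ε₀, hε₀, C, fun ε hε => ?_⟩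
  obtain ⟨⟨h1, h2⟩, h3⟩ := hev ε (by simpa using hε)
  refine ⟨ψ ε, h1, (hball _ (hmem h2 h1)).mpr rfl, fun w hw hres => ?_, ?_⟩
  · exact ((hball _ (hmem h2 hw)).mp hres).symm
  · rwa [Real.norm_of_nonneg (sq_nonneg ε)] at h3

end Reduction

/-! ### Holomorphy of the Green's function -/

section ParametricIntegral

variable {β : Type*} [MeasurableSpace β] {μ : Measure β}

/-- An integral of holomorphic functions with an integrable majorant is holomorphic; Cauchy's
estimate supplies the majorant of the derivative. -/
lemma differentiableOn_integral_of_norm_le {F : ℂ → β → ℂ} {b : β → ℝ} {c : ℂ} {ρ : ℝ}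
    (hF : ∀ z ∈ Metric.ball c ρ, AEStronglyMeasurable (F z) μ)
    (hd : ∀ᵐ t ∂μ, DifferentiableOn ℂ (fun z => F z t) (Metric.ball c ρ))
    (hb : ∀ᵐ t ∂μ, ∀ z ∈ Metric.ball c ρ, ‖F z t‖ ≤ b t) (hbi : Integrable b μ) :
    DifferentiableOn ℂ (fun z => ∫ t, F z t ∂μ) (Metric.ball c ρ) := by
  intro w hw
  obtain ⟨η, hη, hsub⟩ := Metric.isOpen_iff.mp Metric.isOpen_ball w hw
  have hη2 : 0 < η / 2 := by positivity
  have hball : ∀ v ∈ Metric.ball w (η / 2), Metric.ball v (η / 2) ⊆ Metric.ball c ρ := by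
    intro v hv u hu
    refine hsub ?_
    rw [Metric.mem_ball] at hv hu ⊢
    linarith [dist_triangle u v w]
  have hda : ∀ᵐ t ∂μ, ∀ v ∈ Metric.ball w (η / 2),
      HasDerivAt (fun z => F z t) (deriv (fun z => F z t) v) v := by
    filter_upwards [hd] with t ht v hv
    exact (ht.differentiableAt (mem_of_superset (Metric.ball_mem_nhds v hη2)
      (hball v hv))).hasDerivAt
  have hmeas : AEStronglyMeasurable (fun t => deriv (fun z => F z t) w) μ := by
    obtain ⟨u, -, hu, hlim⟩ := exists_seq_strictAnti_tendsto' hη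
    have hmem : ∀ n, w + (u n : ℂ) ∈ Metric.ball c ρ := fun n => hsub (by
      simpa [abs_of_pos (hu n).1] using (hu n).2)
    refine aestronglyMeasurable_of_tendsto_ae atTop
      (f := fun n t => (u n : ℂ)⁻¹ * (F (w + u n) t - F w t))
      (fun n => ((hF _ (hmem n)).sub (hF w hw)).const_mul _) ?_
    filter_upwards [hda] with t ht
    have h1 := hasDerivAt_iff_tendsto_slope_zero.mp (ht w (Metric.mem_ball_self hη2))
    have h2 : Tendsto (fun n => (u n : ℂ)) atTop (𝓝[≠] 0) := by
      refine tendsto_nhdsWithin_iff.mpr ⟨?_, Eventually.of_forall fun n => ?_⟩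
      · simpa [Function.comp_def] using (Complex.continuous_ofReal.tendsto 0).comp hlim
      · simpa using (hu n).1.ne'
    simpa [Function.comp_def] using h1.comp h2
  have key := hasDerivAt_integral_of_dominated_loc_of_deriv_le (μ := μ) (F := F)
    (F' := fun v t => deriv (fun z => F z t) v) (bound := fun t => 2 * b t / (η / 2))
    (Metric.ball_mem_nhds w hη2)
    (by
      filter_upwards [Metric.isOpen_ball.mem_nhds hw] with z hz using hF z hz)
    (hbi.mono' (hF w hw) (by filter_upwards [hb] with t ht using ht w hw)) hmeas
    (by
      filter_upwards [hb, hd] with t ht ht' v hv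
      exact norm_deriv_le_of_ball hη2 (ht'.mono (hball v hv)) fun u hu => ht u (hball v hv hu))
    ((hbi.const_mul 2).div_const _) hda
  exact key.2.differentiableAt.differentiableWithinAt

end ParametricIntegral

section Green

lemma sheet_mem_nhds {N : ℕ} {z₀ : ℂ} (hz₀ : z₀ ∈ sheet N) : sheet N ∈ 𝓝 z₀ := by
  have h1 : ∀ᶠ z in 𝓝 z₀, z ≠ 0 := eventually_ne_nhds hz₀.1
  by_cases hN : Even N
  · have h2 : ∀ᶠ z in 𝓝 z₀, z ∈ Complex.slitPlane :=
      Complex.isOpen_slitPlane.mem_nhds (hz₀.2 hN)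
    filter_upwards [h1, h2] with z h1 h2 using ⟨h1, fun _ => h2⟩
  · filter_upwards [h1] with z h1 using ⟨h1, fun h => absurd h hN⟩

/-- The integrand in the definition of the Green's function in dimension `N ≥ 2`. -/
noncomputable def greenIntegrand (N : ℕ) (z : ℂ) (r t : ℝ) : ℂ :=
  ((Real.exp (-t) * t ^ (((N : ℝ) - 3) / 2) : ℝ) : ℂ) *
    ((t : ℂ) + 2 * z * r) ^ (((N : ℂ) - 3) / 2)

lemma measurable_greenIntegrand (N : ℕ) (z : ℂ) :
    Measurable fun p : ℝ × ℝ => greenIntegrand N z p.1 p.2 := by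
  unfold greenIntegrand
  fun_prop

lemma measurable_greenRadial (N : ℕ) (z : ℂ) : Measurable (greenRadial N z) := by
  have h1 : Measurable fun r : ℝ => ∫ t in Set.Ioi (0 : ℝ), greenIntegrand N z r t :=
    ((measurable_greenIntegrand N z).stronglyMeasurable.integral_prod_right').measurable
  unfold greenRadial
  split_ifs
  · fun_prop
  · simp only [greenIntegrand] at h1
    exact Measurable.mul (by fun_prop) h1

lemma greenRadial_of_ne_one {N : ℕ} (hN : N ≠ 1) (z : ℂ) (r : ℝ) :
    greenRadial N z r = Complex.exp (-(z * r)) /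
      (((4 * Real.pi) ^ (((N : ℝ) - 1) / 2) * Real.Gamma (((N : ℝ) - 1) / 2) * r ^ (N - 2) : ℝ) : ℂ)
      * ∫ t in Set.Ioi (0 : ℝ), greenIntegrand N z r t := by
  rw [greenRadial, if_neg hN]
  rfl

lemma norm_greenIntegrand (N : ℕ) (z : ℂ) (r : ℝ) {t : ℝ} (ht : 0 < t) :
    ‖greenIntegrand N z r t‖ =
      Real.exp (-t) * t ^ (((N : ℝ) - 3) / 2) * ‖(t : ℂ) + 2 * z * r‖ ^ (((N : ℝ) - 3) / 2) := by
  have h1 : ((N : ℂ) - 3) / 2 = ((((N : ℝ) - 3) / 2 : ℝ) : ℂ) := by push_cast; rfl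
  rw [greenIntegrand, norm_mul, h1, Complex.norm_cpow_real, Complex.norm_real,
    Real.norm_of_nonneg (by positivity)]

lemma differentiableAt_greenIntegrand {N : ℕ} (hN : 2 ≤ N) {z : ℂ} (hz : z ∈ sheet N) {r t : ℝ}
    (hr : 0 ≤ r) (ht : 0 < t) : DifferentiableAt ℂ (fun z => greenIntegrand N z r t) z := by
  unfold greenIntegrand
  refine DifferentiableAt.const_mul ?_ _
  rcases Nat.even_or_odd N with hE | hO
  · refine DifferentiableAt.cpow_const (by fun_prop) ?_
    have hs := hz.2 hE
    rw [Complex.mem_slitPlane_iff] at hs ⊢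
    rcases hr.eq_or_lt with rfl | hr
    · left; simpa using ht
    · rcases hs with hs | hs
      · left
        simp
        positivity
      · right
        simp [hs, hr.ne']
  · obtain ⟨n, rfl⟩ := hO
    obtain ⟨m, rfl⟩ : ∃ m, n = m + 1 := ⟨n - 1, by omega⟩
    have h1 : (((2 * (m + 1) + 1 : ℕ) : ℂ) - 3) / 2 = (m : ℂ) := by push_cast; ring
    simp_rw [h1, Complex.cpow_natCast]
    fun_prop

/-- `t + 2 z r` is bounded below by a multiple of `t + r`, uniformly for `z` in a compact subset
of the slit plane. -/
lemma exists_mul_le_norm_add {K : Set ℂ} (hK : IsCompact K) (hKs : K ⊆ Complex.slitPlane) :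
    ∃ c > 0, ∀ z ∈ K, ∀ t r : ℝ, 0 ≤ t → 0 ≤ r → c * (t + r) ≤ ‖(t : ℂ) + 2 * z * r‖ := by
  rcases K.eq_empty_or_nonempty with rfl | hne
  · exact ⟨1, one_pos, by simp⟩
  have hc : IsCompact (Set.Icc (0 : ℝ) 1 ×ˢ K) := isCompact_Icc.prod hK
  obtain ⟨p, hp, hmin⟩ := hc.exists_isMinOn (f := fun p : ℝ × ℂ => ‖(p.1 : ℂ) + (1 - p.1) * p.2‖)
    (Set.Nonempty.prod ⟨0, by simp⟩ hne) (by fun_prop)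
  have hpos : 0 < ‖(p.1 : ℂ) + (1 - p.1) * p.2‖ := by
    rw [norm_pos_iff]
    have h1 := Complex.starConvex_one_slitPlane (hKs hp.2) hp.1.1 (sub_nonneg.mpr hp.1.2)
      (by ring)
    have h2 := Complex.slitPlane_ne_zero h1
    simpa [Complex.real_smul] using h2
  refine ⟨_, hpos, fun z hz t r ht hr => ?_⟩
  rcases (add_nonneg ht (mul_nonneg zero_le_two hr)).eq_or_lt with h0 | h0
  · have h3 : t = 0 := by linarith
    have h4 : r = 0 := by linarith
    simp [h3, h4]
  · set u := t + 2 * r with hu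
    have h5 : (t / u, z) ∈ Set.Icc (0 : ℝ) 1 ×ˢ K :=
      ⟨⟨by positivity, by rw [div_le_one h0]; linarith⟩, hz⟩
    have h6 := hmin h5
    simp only [Set.mem_ofPred_eq] at h6
    have h7 : (t : ℂ) + 2 * z * r = u * (((t / u : ℝ) : ℂ) + (1 - ((t / u : ℝ) : ℂ)) * z) := by
      have : (u : ℂ) ≠ 0 := by exact_mod_cast h0.ne'
      push_cast
      field_simp
      rw [hu]
      push_cast
      ring
    rw [h7, norm_mul, Complex.norm_real, Real.norm_of_nonneg h0.le, mul_comm]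
    exact mul_le_mul (by linarith) h6 (norm_nonneg _) h0.le

end Green

/-! ### Locally uniform bounds for the Green's function -/

section GreenBounds

/-- The normalizing constant `(4π)^((N-1)/2) Γ((N-1)/2)` of the Green's function. -/
noncomputable def greenConst (N : ℕ) : ℝ :=
  (4 * Real.pi) ^ (((N : ℝ) - 1) / 2) * Real.Gamma (((N : ℝ) - 1) / 2)

lemma greenConst_pos {N : ℕ} (hN : 2 ≤ N) : 0 < greenConst N := by
  have h : (2 : ℝ) ≤ N := by exact_mod_cast hN
  have := Real.Gamma_pos_of_pos (s := ((N : ℝ) - 1) / 2) (by linarith)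
  have := Real.pi_pos
  unfold greenConst
  positivity

lemma greenRadial_of_integrand_le {N : ℕ} (hN : 2 ≤ N) {z₀ : ℂ} {ρ σ r : ℝ} (hr : 0 ≤ r)
    (hsheet : Metric.ball z₀ ρ ⊆ sheet N) (hσ : ∀ z ∈ Metric.ball z₀ ρ, -σ ≤ z.re) {b : ℝ → ℝ}
    (hb : ∀ z ∈ Metric.ball z₀ ρ, ∀ t > 0, ‖greenIntegrand N z r t‖ ≤ b t)
    (hbi : IntegrableOn b (Set.Ioi 0)) :
    DifferentiableOn ℂ (fun z => greenRadial N z r) (Metric.ball z₀ ρ) ∧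
      ∀ z ∈ Metric.ball z₀ ρ, ‖greenRadial N z r‖ ≤
        Real.exp (σ * r) / (greenConst N * r ^ (N - 2)) * ∫ t in Set.Ioi 0, b t := by
  have hN1 : N ≠ 1 := by omega
  constructor
  · simp_rw [greenRadial_of_ne_one hN1]
    refine DifferentiableOn.mul (by fun_prop) (differentiableOn_integral_of_norm_le
      (b := b) (fun z _ => ?_) ?_ ?_ hbi)
    · exact ((measurable_greenIntegrand N z).comp
        (measurable_const.prodMk measurable_id)).aestronglyMeasurable
    · filter_upwards [ae_restrict_mem measurableSet_Ioi] with t ht z hz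
      exact (differentiableAt_greenIntegrand hN (hsheet hz) hr ht).differentiableWithinAt
    · filter_upwards [ae_restrict_mem measurableSet_Ioi] with t ht z hz using hb z hz t ht
  · intro z hz
    rw [greenRadial_of_ne_one hN1, norm_mul, norm_div, Complex.norm_exp, Complex.norm_real]
    have h1 : ‖∫ t in Set.Ioi (0 : ℝ), greenIntegrand N z r t‖ ≤ ∫ t in Set.Ioi 0, b t := by
      refine norm_integral_le_of_norm_le hbi ?_
      filter_upwards [ae_restrict_mem measurableSet_Ioi] with t ht using hb z hz t ht
    have hc := greenConst_pos hN
    have h2 : ‖(4 * Real.pi) ^ (((N : ℝ) - 1) / 2) * Real.Gamma (((N : ℝ) - 1) / 2) * r ^ (N - 2)‖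
        = greenConst N * r ^ (N - 2) := by
      rw [Real.norm_of_nonneg]
      · rfl
      · exact mul_nonneg hc.le (by positivity)
    rw [h2]
    gcongr
    have := mul_le_mul_of_nonneg_right (hσ z hz) hr
    simp
    linarith

lemma exists_ball_subset_sheet {N : ℕ} {z₀ : ℂ} (hz₀ : z₀ ∈ sheet N) {σ : ℝ} (hσ : -z₀.re < σ) :
    ∃ ρ > 0, Metric.closedBall z₀ ρ ⊆ sheet N ∧ ∀ z ∈ Metric.ball z₀ ρ, -σ ≤ z.re := by
  obtain ⟨ρ₁, hρ₁, h1⟩ := Metric.nhds_basis_closedBall.mem_iff.mp (sheet_mem_nhds hz₀)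
  refine ⟨min ρ₁ (z₀.re + σ), lt_min hρ₁ (by linarith),
    (Metric.closedBall_subset_closedBall (min_le_left _ _)).trans h1, fun z hz => ?_⟩
  rw [mem_ball_iff_norm] at hz
  have h2 := (Complex.abs_re_le_norm (z - z₀)).trans_lt (hz.trans_le (min_le_right _ _))
  rw [Complex.sub_re, abs_lt] at h2
  linarith

lemma one_add_rpow_le {s m : ℝ} (hs : 0 ≤ s) (hm : 0 ≤ m) :
    (1 + s) ^ m ≤ 2 ^ m * (1 + s ^ m) := by
  rcases le_total s 1 with h | h
  · calc (1 + s) ^ m ≤ 2 ^ m := Real.rpow_le_rpow (by linarith) (by linarith) hm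
      _ ≤ _ := le_mul_of_one_le_right (by positivity) (by linarith [Real.rpow_nonneg hs m])
  · calc (1 + s) ^ m ≤ (2 * s) ^ m := Real.rpow_le_rpow (by linarith) (by linarith) hm
      _ = 2 ^ m * s ^ m := Real.mul_rpow (by norm_num) hs
      _ ≤ _ := by gcongr; linarith

lemma integrableOn_exp_neg_mul_rpow {m : ℝ} (hm : -1 < m) :
    IntegrableOn (fun t => Real.exp (-t) * t ^ m) (Set.Ioi 0) := by
  simpa using Real.GammaIntegral_convergent (s := m + 1) (by linarith)

/-- The exponent `α` is admissible if `r^(-α)` bounds the singularity of the Green's function at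
`r = 0` (which is logarithmic for `N = 2`). -/
def AdmissibleExponent (N : ℕ) (α : ℝ) : Prop :=
  (N = 1 ∧ α = 0) ∨ (N = 2 ∧ 0 < α ∧ α ≤ 1 / 2) ∨ (3 ≤ N ∧ α = (N : ℝ) - 2)

/-- Locally uniformly in the spectral parameter, the Green's function is bounded by
`e^(σ r) (1 + r^(-α))`, for every `σ` exceeding `-Re z₀`. -/
theorem exists_greenRadial_bound {N : ℕ} {z₀ : ℂ} (hz₀ : z₀ ∈ sheet N) {σ : ℝ}
    (hσ : -z₀.re < σ) {α : ℝ} (hα : AdmissibleExponent N α) :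
    ∃ ρ > 0, ∃ C : ℝ≥0, Metric.ball z₀ ρ ⊆ sheet N ∧ ∀ r, 0 ≤ r →
      DifferentiableOn ℂ (fun z => greenRadial N z r) (Metric.ball z₀ ρ) ∧
      ∀ z ∈ Metric.ball z₀ ρ,
        ‖greenRadial N z r‖ ≤ C * (Real.exp (σ * r) * (1 + r ^ (-α))) := by
  obtain ⟨ρ, hρ, hsheetc, hre⟩ := exists_ball_subset_sheet hz₀ hσ
  have hsheet := Metric.ball_subset_closedBall.trans hsheetc
  rcases hα with ⟨rfl, rfl⟩ | ⟨rfl, hα0, hα1⟩ | ⟨hN, rfl⟩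
  · -- dimension one: `exp (-z r) / (2 z)`, with `z` bounded away from zero
    obtain ⟨c, hc, hcb⟩ : ∃ c > 0, ∀ z ∈ Metric.closedBall z₀ ρ, c ≤ ‖z‖ := by
      obtain ⟨w, hw, hmin⟩ := (isCompact_closedBall z₀ ρ).exists_isMinOn
        ⟨z₀, Metric.mem_closedBall_self hρ.le⟩ continuous_norm.continuousOn
      exact ⟨‖w‖, norm_pos_iff.mpr (hsheetc hw).1, fun z hz => hmin hz⟩
    refine ⟨ρ, hρ, (1 / (2 * c)).toNNReal, hsheet, fun r hr => ⟨?_, fun z hz => ?_⟩⟩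
    · simp only [greenRadial, if_true]
      intro z hz
      refine DifferentiableAt.differentiableWithinAt (DifferentiableAt.div (by fun_prop)
        (by fun_prop) (mul_ne_zero two_ne_zero (hsheet hz).1))
    · simp only [greenRadial, if_true, neg_zero, Real.rpow_zero]
      rw [norm_div, Complex.norm_exp, norm_mul, Complex.norm_ofNat,
        Real.coe_toNNReal _ (by positivity)]
      have h1 := hcb z (Metric.ball_subset_closedBall hz)
      have h2 : Real.exp (-(z * r)).re ≤ Real.exp (σ * r) := by
        gcongr
        have := mul_le_mul_of_nonneg_right (hre z hz) hr
        simp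
        linarith
      calc _ ≤ Real.exp (σ * r) / (2 * c) := by gcongr
        _ ≤ _ := by
          rw [div_eq_mul_one_div, mul_comm]
          gcongr
          nlinarith [Real.exp_pos (σ * r)]
  · -- dimension two: half of the decay of `(t + r)^(-1/2)` is spent on integrability in `t`
    obtain ⟨c, hc, hcb⟩ := exists_mul_le_norm_add (isCompact_closedBall z₀ ρ)
      (fun z hz => (hsheetc hz).2 even_two)
    set A : ℝ := c ^ (-(1 / 2) : ℝ) with hA
    set I : ℝ := ∫ t in Set.Ioi (0 : ℝ), Real.exp (-t) * t ^ (α - 1) with hI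
    have hI0 : 0 ≤ I := setIntegral_nonneg measurableSet_Ioi fun t ht => by
      have := Set.mem_Ioi.mp ht; positivity
    have hc2 := greenConst_pos (le_refl 2)
    refine ⟨ρ, hρ, (A * I / greenConst 2 + ‖greenRadial 2 z₀ 0‖).toNNReal, hsheet,
      fun r hr => ?_⟩
    rw [Real.coe_toNNReal _ (by positivity)]
    rcases hr.eq_or_lt with rfl | hr
    · -- at `r = 0` the function does not depend on `z`
      have h0 : ∀ z, greenRadial 2 z 0 = greenRadial 2 z₀ 0 := fun z => by simp [greenRadial]
      refine ⟨?_, fun z hz => ?_⟩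
      · simp_rw [h0]
        exact differentiableOn_const _
      · rw [h0, Real.zero_rpow (by linarith)]
        simp only [mul_zero, Real.exp_zero, add_zero, mul_one]
        have : 0 ≤ A * I / greenConst 2 := by positivity
        linarith
    · have hint : ∀ z ∈ Metric.ball z₀ ρ, ∀ t > 0, ‖greenIntegrand 2 z r t‖ ≤
          A * r ^ (-α) * (Real.exp (-t) * t ^ (α - 1)) := fun z hz t ht => by
        have h1 := hcb z (Metric.ball_subset_closedBall hz) t r ht.le hr.le
        have h2 : (((2 : ℕ) : ℝ) - 3) / 2 = -(1 / 2) := by norm_num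
        rw [norm_greenIntegrand 2 z r ht, h2]
        have h3 : ‖(t : ℂ) + 2 * z * r‖ ^ (-(1 / 2) : ℝ) ≤ A * (t ^ (α - 1 / 2) * r ^ (-α)) := by
          calc _ ≤ (c * (t + r)) ^ (-(1 / 2) : ℝ) :=
                Real.rpow_le_rpow_of_nonpos (by positivity) h1 (by norm_num)
            _ = A * ((t + r) ^ (α - 1 / 2) * (t + r) ^ (-α)) := by
                rw [Real.mul_rpow hc.le (by positivity), ← Real.rpow_add (by positivity)]
                congr 2
                ring
            _ ≤ _ := by
                gcongr ?_ * (?_ * ?_)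
                · exact Real.rpow_le_rpow_of_nonpos ht (by linarith) (by linarith)
                · exact Real.rpow_le_rpow_of_nonpos hr (by linarith) (by linarith)
        calc _ ≤ Real.exp (-t) * t ^ (-(1 / 2) : ℝ) * (A * (t ^ (α - 1 / 2) * r ^ (-α))) := by
              gcongr
          _ = A * r ^ (-α) * (Real.exp (-t) * (t ^ (-(1 / 2) : ℝ) * t ^ (α - 1 / 2))) := by ring
          _ = _ := by
              rw [← Real.rpow_add ht]
              congr 3
              ring
      obtain ⟨h1, h2⟩ := greenRadial_of_integrand_le le_rfl hr.le hsheet hre hint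
        ((integrableOn_exp_neg_mul_rpow (by linarith)).const_mul _)
      refine ⟨h1, fun z hz => (h2 z hz).trans ?_⟩
      rw [integral_const_mul, ← hI]
      have hpow := Real.rpow_nonneg hr.le (-α)
      calc _ = A * I / greenConst 2 * (Real.exp (σ * r) * r ^ (-α)) := by
            simp only [Nat.sub_self, pow_zero]; ring
        _ ≤ _ := by
            gcongr
            · linarith [norm_nonneg (greenRadial 2 z₀ 0)]
            · linarith
  · -- higher dimensions: the integral grows at most like `(1 + r)^((N-3)/2)`
    set m : ℝ := ((N : ℝ) - 3) / 2 with hm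
    have hN' : (3 : ℝ) ≤ N := by exact_mod_cast hN
    have hm0 : 0 ≤ m := by rw [hm]; linarith
    have hc := greenConst_pos (show 2 ≤ N by omega)
    set B : ℝ := 1 + 2 * (‖z₀‖ + ρ) with hB
    have hB0 : 0 < B := by positivity
    set I : ℝ := ∫ t in Set.Ioi (0 : ℝ), (Real.exp (-t) * t ^ m + Real.exp (-t) * t ^ (2 * m))
      with hI
    have hI0 : 0 ≤ I := setIntegral_nonneg measurableSet_Ioi fun t ht => by
      have := Set.mem_Ioi.mp ht; positivity
    refine ⟨ρ, hρ, (2 ^ m * (B ^ m * 2 ^ m * I) / greenConst N).toNNReal, hsheet,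
      fun r hr => ?_⟩
    rw [Real.coe_toNNReal _ (by positivity)]
    have hint : ∀ z ∈ Metric.ball z₀ ρ, ∀ t > 0, ‖greenIntegrand N z r t‖ ≤
        B ^ m * (1 + r) ^ m * 2 ^ m * (Real.exp (-t) * t ^ m + Real.exp (-t) * t ^ (2 * m)) :=
      fun z hz t ht => by
        have hz' : ‖z‖ ≤ ‖z₀‖ + ρ := by
          rw [mem_ball_iff_norm] at hz
          linarith [norm_le_norm_add_norm_sub' z z₀]
        have h1 : ‖(t : ℂ) + 2 * z * r‖ ≤ B * (1 + r) * (1 + t) := by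
          calc _ ≤ t + 2 * ‖z‖ * r := by
                refine (norm_add_le _ _).trans_eq ?_
                simp [abs_of_pos ht, abs_of_nonneg hr]
            _ ≤ t + 2 * (‖z₀‖ + ρ) * r := by gcongr
            _ ≤ _ := by
                have h2 : 0 ≤ 2 * (‖z₀‖ + ρ) := by positivity
                rw [hB]
                generalize 2 * (‖z₀‖ + ρ) = a at h2
                nlinarith [mul_nonneg h2 hr, mul_nonneg h2 ht.le, mul_nonneg hr ht.le,
                  mul_nonneg (mul_nonneg h2 hr) ht.le]
        rw [norm_greenIntegrand N z r ht, ← hm]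
        calc _ ≤ Real.exp (-t) * t ^ m * (B * (1 + r) * (1 + t)) ^ m := by gcongr
          _ = Real.exp (-t) * t ^ m * (B ^ m * (1 + r) ^ m * (1 + t) ^ m) := by
              rw [Real.mul_rpow (by positivity) (by positivity),
                Real.mul_rpow hB0.le (by positivity)]
          _ ≤ Real.exp (-t) * t ^ m * (B ^ m * (1 + r) ^ m * (2 ^ m * (1 + t ^ m))) := by
              gcongr
              exact one_add_rpow_le ht.le hm0
          _ = _ := by
              rw [two_mul m, Real.rpow_add ht]
              ring
    obtain ⟨h1, h2⟩ := greenRadial_of_integrand_le (by omega) hr hsheet hre hint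
      (((integrableOn_exp_neg_mul_rpow (by linarith)).add
        (integrableOn_exp_neg_mul_rpow (by linarith))).const_mul _)
    refine ⟨h1, fun z hz => (h2 z hz).trans ?_⟩
    rw [integral_const_mul, ← hI]
    rcases hr.eq_or_lt with rfl | hr
    · -- at `r = 0` the formula divides by zero, and the value is zero
      rw [zero_pow (by omega)]
      simp only [mul_zero, div_zero, zero_mul]
      positivity
    · have hpow : r ^ (-((N : ℝ) - 2)) = (r ^ (N - 2))⁻¹ := by
        rw [Real.rpow_neg hr.le, ← Real.rpow_natCast]
        congr 2
        rw [Nat.cast_sub (by omega)]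
        norm_num
      have h3 : (1 + r) ^ m / r ^ (N - 2) ≤ 2 ^ m * (1 + r ^ (-((N : ℝ) - 2))) := by
        rw [hpow, div_eq_mul_inv]
        rcases le_total r 1 with hr1 | hr1
        · have : (1 + r) ^ m ≤ 2 ^ m := Real.rpow_le_rpow (by linarith) (by linarith) hm0
          gcongr
          linarith
        · have h4 : (1 + r) ^ m ≤ 2 ^ m * r ^ m := by
            rw [← Real.mul_rpow (by norm_num) hr.le]
            exact Real.rpow_le_rpow (by linarith) (by linarith) hm0
          have h5 : r ^ m ≤ r ^ (N - 2) := by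
            rw [← Real.rpow_natCast]
            refine Real.rpow_le_rpow_of_exponent_le hr1 ?_
            rw [Nat.cast_sub (by omega), hm]
            push_cast
            linarith
          have hp : 0 < r ^ (N - 2) := by positivity
          calc _ ≤ 2 ^ m * r ^ (N - 2) * (r ^ (N - 2))⁻¹ := by
                gcongr
                exact h4.trans (by gcongr)
            _ = 2 ^ m * 1 := by field_simp
            _ ≤ _ := by
                gcongr
                linarith [inv_pos.mpr hp]
      calc _ = B ^ m * 2 ^ m * I / greenConst N * Real.exp (σ * r) *
            ((1 + r) ^ m / r ^ (N - 2)) := by field_simp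
        _ ≤ B ^ m * 2 ^ m * I / greenConst N * Real.exp (σ * r) *
            (2 ^ m * (1 + r ^ (-((N : ℝ) - 2)))) := by gcongr
        _ = _ := by ring

end GreenBounds

/-! ### The local singularity and Hölder's inequality -/

section Kato

/-- If `p > N/2`, the singularity `r^(-α)` of the Green's function is locally in the dual space
`L^{p'}`; in dimensions `N ≥ 2` with room to spare. -/
lemma exists_admissibleExponent {N : ℕ} (hN : 1 ≤ N) {p p' : ℝ≥0∞} (hpN : (N : ℝ≥0∞) / 2 < p)
    [p.HolderConjugate p'] : ∃ α, AdmissibleExponent N α ∧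
      ((N = 1 ∧ α = 0) ∨ (0 < α ∧ p' ≠ ∞ ∧ α * p'.toReal < N)) := by
  rcases hN.eq_or_lt with rfl | hN2
  · exact ⟨0, Or.inl ⟨rfl, rfl⟩, Or.inl ⟨rfl, rfl⟩⟩
  have hN0 : (0 : ℝ) < N := by positivity
  have hp1 : 1 < p := by
    refine lt_of_le_of_lt ?_ hpN
    rw [ENNReal.le_div_iff_mul_le (by simp) (by simp)]
    rw [one_mul]
    exact_mod_cast hN2
  have hp' : p' ≠ ∞ := ((ENNReal.HolderConjugate.lt_top_iff_one_lt p' p).mpr hp1).ne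
  have hp'0 : p' ≠ 0 := ENNReal.HolderConjugate.ne_zero p' p
  have ht : 0 < p'.toReal := ENNReal.toReal_pos hp'0 hp'
  have hsum : (p⁻¹).toReal + p'.toReal⁻¹ = 1 := by
    have h := congrArg ENNReal.toReal (ENNReal.HolderConjugate.inv_add_inv_eq_one p p')
    rwa [ENNReal.toReal_add (by simp [(zero_lt_one.trans hp1).ne']) (by simp [hp'0]),
      ENNReal.toReal_inv p', ENNReal.toReal_one] at h
  have ht1 : 1 ≤ p'.toReal := by
    rw [← inv_le_one₀ ht]
    linarith [ENNReal.toReal_nonneg (a := p⁻¹)]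
  rcases (Nat.succ_le_of_lt hN2).eq_or_lt with h2 | h3
  · subst h2
    refine ⟨1 / (2 * p'.toReal), Or.inr (Or.inl ⟨rfl, by positivity, ?_⟩),
      Or.inr ⟨by positivity, hp', ?_⟩⟩
    · rw [div_le_div_iff₀ (by positivity) (by norm_num)]
      linarith
    · field_simp
      norm_num
  · have h3' : (3 : ℝ) ≤ N := by exact_mod_cast h3
    refine ⟨(N : ℝ) - 2, Or.inr (Or.inr ⟨h3, rfl⟩), Or.inr ⟨by linarith, hp', ?_⟩⟩
    have h4 : (p⁻¹).toReal < 2 / N := by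
      have h5 : p⁻¹ < ((N : ℝ≥0∞) / 2)⁻¹ := ENNReal.inv_lt_inv.mpr hpN
      have h6 := ENNReal.toReal_strict_mono (by simp; omega) h5
      simpa using h6
    have h7 : 1 - 2 / (N : ℝ) < p'.toReal⁻¹ := by linarith
    have h8 := mul_lt_mul_of_pos_right h7 (mul_pos ht hN0)
    have h9 : (1 - 2 / (N : ℝ)) * (p'.toReal * N) = ((N : ℝ) - 2) * p'.toReal := by
      field_simp
    have h10 : p'.toReal⁻¹ * (p'.toReal * N) = N := by field_simp
    linarith

lemma memLp_exp_neg_mul_norm {N : ℕ} (hN : 1 ≤ N) {c : ℝ} (hc : 0 < c) (p : ℝ≥0∞) :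
    MemLp (fun y : Space N => Real.exp (-(c * ‖y‖))) p := by
  have hm : AEStronglyMeasurable (fun y : Space N => Real.exp (-(c * ‖y‖))) :=
    (by fun_prop : Continuous fun y : Space N => Real.exp (-(c * ‖y‖))).aestronglyMeasurable
  rcases eq_or_ne p ∞ with rfl | hp
  · refine memLp_top_of_bound hm 1 (Eventually.of_forall fun y => ?_)
    rw [Real.norm_of_nonneg (Real.exp_pos _).le]
    exact Real.exp_le_one_iff.mpr (by simp; positivity)
  rcases eq_or_ne p 0 with rfl | hp0
  · exact memLp_zero_iff_aestronglyMeasurable.mpr hm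
  have ht : 0 < p.toReal := ENNReal.toReal_pos hp0 hp
  rw [← integrable_norm_rpow_iff hm hp0 hp]
  have : Nonempty (Fin N) := ⟨⟨0, hN⟩⟩
  have h1 : (fun y : Space N => ‖Real.exp (-(c * ‖y‖))‖ ^ p.toReal) =
      fun y => (fun r : ℝ => Real.exp (-(c * p.toReal * r))) ‖y‖ := by
    funext y
    rw [Real.norm_of_nonneg (Real.exp_pos _).le, ← Real.exp_mul]
    congr 1
    ring
  rw [h1]
  refine (integrable_fun_norm_addHaar (volume : Measure (Space N))
    (f := fun r : ℝ => Real.exp (-(c * p.toReal * r)))).mpr ?_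
  have h2 := integrableOn_rpow_mul_exp_neg_mul_rpow (p := 1) (s := ((N - 1 : ℕ) : ℝ))
    (b := c * p.toReal) (by linarith [Nat.cast_nonneg (α := ℝ) (N - 1)]) one_pos (by positivity)
  refine h2.congr_fun (fun r hr => ?_) measurableSet_Ioi
  simp

/-- The local singularity `r^(-β)`, cut off at distance one. -/
noncomputable def localSingularity (N : ℕ) (β : ℝ) : Space N → ℝ :=
  (Metric.ball 0 1).indicator fun y => ‖y‖ ^ (-β)

lemma measurable_localSingularity (N : ℕ) (β : ℝ) : Measurable (localSingularity N β) :=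
  (by fun_prop : Measurable fun y : Space N => ‖y‖ ^ (-β)).indicator measurableSet_ball

lemma localSingularity_nonneg (N : ℕ) (β : ℝ) (y : Space N) : 0 ≤ localSingularity N β y :=
  Set.indicator_nonneg (fun y _ => by positivity) y

lemma memLp_localSingularity_zero (N : ℕ) (p : ℝ≥0∞) : MemLp (localSingularity N 0) p := by
  unfold localSingularity
  simp only [neg_zero, Real.rpow_zero]
  exact memLp_indicator_const p measurableSet_ball 1 (Or.inr measure_ball_lt_top.ne)

lemma memLp_localSingularity {N : ℕ} (hN : 1 ≤ N) {β : ℝ} {p : ℝ≥0∞} (hp0 : p ≠ 0) (hp : p ≠ ∞)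
    (hβ : β * p.toReal < N) : MemLp (localSingularity N β) p := by
  rw [← integrable_norm_rpow_iff (measurable_localSingularity N β).aestronglyMeasurable hp0 hp]
  have ht : 0 < p.toReal := ENNReal.toReal_pos hp0 hp
  have : Nonempty (Fin N) := ⟨⟨0, hN⟩⟩
  have h1 : (fun y : Space N => ‖localSingularity N β y‖ ^ p.toReal) =
      (Metric.ball 0 1).indicator fun y => (fun r : ℝ => r ^ (-(β * p.toReal))) ‖y‖ := by
    funext y
    unfold localSingularity
    by_cases hy : y ∈ Metric.ball (0 : Space N) 1
    · rw [Set.indicator_of_mem hy, Set.indicator_of_mem hy, Real.norm_of_nonneg (by positivity),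
        ← Real.rpow_mul (norm_nonneg y)]
      simp
    · rw [Set.indicator_of_notMem hy, Set.indicator_of_notMem hy, norm_zero,
        Real.zero_rpow ht.ne']
  rw [h1, integrable_indicator_iff measurableSet_ball]
  refine (integrableOn_fun_norm_addHaar (volume : Measure (Space N))
    (f := fun r : ℝ => r ^ (-(β * p.toReal)))).mpr ?_
  have h2 := (intervalIntegral.integrableOn_Ioo_rpow_iff
    (s := ((N - 1 : ℕ) : ℝ) + -(β * p.toReal)) one_pos).mpr (by
      rw [Nat.cast_sub hN]
      push_cast
      linarith)
  refine h2.congr_fun (fun r hr => ?_) measurableSet_Ioo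
  simp only
  rw [Real.rpow_add hr.1, Real.rpow_natCast]
  simp

/-- Hölder's inequality for nonnegative functions, with a translated and reflected factor. -/
lemma lintegral_ofReal_mul_le {N : ℕ} {p p' : ℝ≥0∞} [p.HolderConjugate p'] {u R : Space N → ℝ}
    (hu : Measurable u) (hu0 : ∀ y, 0 ≤ u y) (hR : MemLp R p) (hR0 : ∀ y, 0 ≤ R y) (x : Space N) :
    ∫⁻ y, ENNReal.ofReal (u (x - y) * R y) ≤ eLpNorm u p' * eLpNorm R p := by
  have hmp : MeasurePreserving (fun y : Space N => x - y) volume volume :=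
    Measure.measurePreserving_sub_left volume x
  have h1 := eLpNorm_smul_le_mul_eLpNorm (p := p') (q := p) (r := 1) hR.1
    (φ := fun y => u (x - y)) ((hu.comp hmp.measurable).aestronglyMeasurable)
  rw [eLpNorm_one_eq_lintegral_enorm] at h1
  have h2 : eLpNorm (fun y => u (x - y)) p' = eLpNorm u p' :=
    eLpNorm_comp_measurePreserving hu.aestronglyMeasurable hmp
  rw [h2] at h1
  refine le_trans (le_of_eq (lintegral_congr fun y => ?_)) h1
  rw [Pi.smul_apply', smul_eq_mul, ← ofReal_norm, Real.norm_of_nonneg (mul_nonneg (hu0 _) (hR0 _))]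

end Kato

/-! ### Holomorphic families of sandwiched Green's operators -/

section WeightedKernels

variable {N : ℕ} {γ σ : ℝ} {p p' : ℝ≥0∞} {Q : Space N → ℝ}

/-- The weight `e^(σ|x|) Q(x)^(1/2)` of the Schur test; the exponential absorbs the growth of the
Green's function. -/
noncomputable def expWeight (σ : ℝ) (Q : Space N → ℝ) (x : Space N) : ℝ :=
  Real.exp (σ * ‖x‖) * √(Q x)

/-- The kernel `Q(x)^(1/2) G(x, y; z) Q(y)^(1/2)`. -/
noncomputable def sandwichedGreen (Q : Space N → ℝ) (z : ℂ) (x y : Space N) : ℂ :=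
  (√(Q x) : ℂ) * green x y z * (√(Q y) : ℂ)

lemma measurable_expWeight (hQm : Measurable Q) : Measurable (expWeight σ Q) := by
  unfold expWeight
  fun_prop

lemma expWeight_nonneg (x : Space N) : 0 ≤ expWeight σ Q x := by
  unfold expWeight
  positivity

lemma expWeight_sq (hQ0 : ∀ x, 0 ≤ Q x) (x : Space N) :
    expWeight σ Q x ^ 2 =
      Real.exp (-((γ - 2 * σ) * ‖x‖)) * (Real.exp (γ * ‖x‖) * Q x) := by
  rw [expWeight, mul_pow, Real.sq_sqrt (hQ0 x), ← Real.exp_nat_mul,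
    ← mul_assoc (Real.exp (-((γ - 2 * σ) * ‖x‖))), ← Real.exp_add]
  congr 2
  push_cast
  ring

lemma expWeight_sq_le (hσ : 2 * σ < γ) (hQ0 : ∀ x, 0 ≤ Q x) (x : Space N) :
    expWeight σ Q x ^ 2 ≤ Real.exp (γ * ‖x‖) * Q x := by
  rw [expWeight_sq (γ := γ) hQ0]
  refine mul_le_of_le_one_left (mul_nonneg (Real.exp_pos _).le (hQ0 x)) ?_
  rw [Real.exp_le_one_iff]
  have := mul_nonneg (sub_nonneg.mpr hσ.le) (norm_nonneg x)
  linarith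

lemma lintegral_expWeight_sq_lt_top (hN : 1 ≤ N) [p.HolderConjugate p'] (hσ : 2 * σ < γ)
    (hQ0 : ∀ x, 0 ≤ Q x) (hQ : MemLp (fun x => Real.exp (γ * ‖x‖) * Q x) p) :
    ∫⁻ x, ENNReal.ofReal (expWeight σ Q x ^ 2) < ∞ := by
  have he := memLp_exp_neg_mul_norm hN (sub_pos.mpr hσ) p'
  have h := lintegral_ofReal_mul_le (p := p) (p' := p')
    (u := fun y : Space N => Real.exp (-((γ - 2 * σ) * ‖y‖))) (by fun_prop)
    (fun y => (Real.exp_pos _).le) hQ (fun y => mul_nonneg (Real.exp_pos _).le (hQ0 y)) 0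
  refine lt_of_le_of_lt (le_of_eq (lintegral_congr fun x => ?_))
    (h.trans_lt (ENNReal.mul_lt_top he.2 hQ.2))
  rw [expWeight_sq (γ := γ) hQ0, zero_sub, norm_neg]

lemma one_add_rpow_mul_expWeight_sq_le (hσ : 2 * σ < γ) (hQ0 : ∀ x, 0 ≤ Q x) {α : ℝ} (hα : 0 ≤ α)
    (x y : Space N) : (1 + dist x y ^ (-α)) * expWeight σ Q y ^ 2 ≤
      2 * expWeight σ Q y ^ 2 + localSingularity N α (x - y) * (Real.exp (γ * ‖y‖) * Q y) := by
  have h1 := expWeight_sq_le hσ hQ0 y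
  have h0 := sq_nonneg (expWeight σ Q y)
  have hl := localSingularity_nonneg N α (x - y)
  rw [dist_eq_norm]
  rcases lt_or_ge ‖x - y‖ 1 with h | h
  · have h2 : localSingularity N α (x - y) = ‖x - y‖ ^ (-α) := by
      rw [localSingularity, Set.indicator_of_mem (by simpa using h)]
    rw [h2] at hl ⊢
    nlinarith [mul_le_mul_of_nonneg_left h1 hl]
  · have h2 : ‖x - y‖ ^ (-α) ≤ 1 := Real.rpow_le_one_of_one_le_of_nonpos h (by linarith)
    nlinarith [mul_nonneg hl (h0.trans h1), mul_le_mul_of_nonneg_right h2 h0]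

/-- The Schur bound for `1 + |x - y|^(-α)`. -/
lemma exists_schurBound (hN : 1 ≤ N) [p.HolderConjugate p'] (hσ : 2 * σ < γ) (hQm : Measurable Q)
    (hQ0 : ∀ x, 0 ≤ Q x) (hQ : MemLp (fun x => Real.exp (γ * ‖x‖) * Q x) p) {α : ℝ} (hα : 0 ≤ α)
    (hα' : MemLp (localSingularity N α) p') :
    ∃ M, SchurBound volume (expWeight σ Q) (fun x y => 1 + dist x y ^ (-α)) M := by
  set B : ℝ≥0∞ := 2 * (∫⁻ x, ENNReal.ofReal (expWeight σ Q x ^ 2)) +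
    eLpNorm (localSingularity N α) p' * eLpNorm (fun x => Real.exp (γ * ‖x‖) * Q x) p with hB
  have hBt : B < ∞ := ENNReal.add_lt_top.mpr
    ⟨ENNReal.mul_lt_top (by simp) (lintegral_expWeight_sq_lt_top (p' := p') hN hσ hQ0 hQ),
      ENNReal.mul_lt_top hα'.2 hQ.2⟩
  refine ⟨B.toNNReal, measurable_expWeight hQm, ?_, expWeight_nonneg,
    fun x y => by positivity, fun x y => by rw [dist_comm], fun x => ?_⟩
  · unfold Function.uncurry
    fun_prop
  rw [ENNReal.coe_toNNReal hBt.ne]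
  calc _ ≤ ∫⁻ y, (2 * ENNReal.ofReal (expWeight σ Q y ^ 2) +
        ENNReal.ofReal (localSingularity N α (x - y) * (Real.exp (γ * ‖y‖) * Q y))) := by
        refine lintegral_mono fun y => ?_
        refine (ENNReal.ofReal_le_ofReal
          (one_add_rpow_mul_expWeight_sq_le hσ hQ0 hα x y)).trans ENNReal.ofReal_add_le |>.trans ?_
        rw [ENNReal.ofReal_mul (by norm_num)]
        simp
    _ ≤ B := by
        have hm : Measurable fun y => 2 * ENNReal.ofReal (expWeight σ Q y ^ 2) :=
          (((measurable_expWeight hQm).pow_const 2).ennreal_ofReal).const_mul _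
        rw [lintegral_add_left hm, lintegral_const_mul' _ _ (by simp), hB]
        gcongr
        exact lintegral_ofReal_mul_le (measurable_localSingularity N α)
          (localSingularity_nonneg N α) hQ (fun y => mul_nonneg (Real.exp_pos _).le (hQ0 y)) x

/-- The Schur bound for the part of `1 + |x - y|^(-α)` near the diagonal is small. -/
lemma schurBound_near (hσ : 2 * σ < γ) [p.HolderConjugate p'] (hQm : Measurable Q)
    (hQ0 : ∀ x, 0 ≤ Q x) (hQ : MemLp (fun x => Real.exp (γ * ‖x‖) * Q x) p) {α β : ℝ}
    (hα : 0 ≤ α) (hαβ : α ≤ β) (hβ : MemLp (localSingularity N β) p') {η : ℝ} (hη : 0 < η)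
    (hη1 : η ≤ 1) :
    SchurBound volume (expWeight σ Q)
      (fun x y => if 0 < dist x y ∧ dist x y < η then 1 + dist x y ^ (-α) else 0)
      ((2 * η ^ (β - α)).toNNReal * (eLpNorm (localSingularity N β) p' *
        eLpNorm (fun x => Real.exp (γ * ‖x‖) * Q x) p).toNNReal) where
  measurable_weight := measurable_expWeight hQm
  measurable_kernel := by
    unfold Function.uncurry
    refine Measurable.ite ?_ (by fun_prop) measurable_const
    exact (measurableSet_lt measurable_const measurable_dist).inter
      (measurableSet_lt measurable_dist measurable_const)
  weight_nonneg := expWeight_nonneg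
  kernel_nonneg x y := by split_ifs <;> positivity
  symm x y := by rw [dist_comm]
  lintegral_le x := by
    rw [ENNReal.coe_mul, ENNReal.coe_toNNReal (ENNReal.mul_lt_top hβ.2 hQ.2).ne]
    have hpt : ∀ y, (if 0 < dist x y ∧ dist x y < η then 1 + dist x y ^ (-α) else 0) *
        expWeight σ Q y ^ 2 ≤ (2 * η ^ (β - α)) *
          (localSingularity N β (x - y) * (Real.exp (γ * ‖y‖) * Q y)) := fun y => by
      have hR := mul_nonneg (Real.exp_pos (γ * ‖y‖)).le (hQ0 y)
      split_ifs with h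
      · rw [dist_eq_norm] at h ⊢
        have h2 : localSingularity N β (x - y) = ‖x - y‖ ^ (-β) := by
          rw [localSingularity, Set.indicator_of_mem (by simpa using h.2.trans_le hη1)]
        have h3 : 1 ≤ ‖x - y‖ ^ (-α) :=
          Real.one_le_rpow_of_pos_of_le_one_of_nonpos h.1 (h.2.le.trans hη1) (by linarith)
        have h4 : ‖x - y‖ ^ (-α) ≤ η ^ (β - α) * ‖x - y‖ ^ (-β) := by
          have : ‖x - y‖ ^ (-α) = ‖x - y‖ ^ (β - α) * ‖x - y‖ ^ (-β) := by
            rw [← Real.rpow_add h.1]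
            congr 1
            ring
          rw [this]
          gcongr
          exact h.2.le
        rw [h2]
        calc _ ≤ (2 * (η ^ (β - α) * ‖x - y‖ ^ (-β))) * (Real.exp (γ * ‖y‖) * Q y) := by
              refine mul_le_mul (by linarith) (expWeight_sq_le hσ hQ0 y) (sq_nonneg _)
                (by positivity)
          _ = _ := by ring
      · rw [zero_mul]
        have := localSingularity_nonneg N β (x - y)
        positivity
    calc _ ≤ ∫⁻ y, ENNReal.ofReal (2 * η ^ (β - α)) *
          ENNReal.ofReal (localSingularity N β (x - y) * (Real.exp (γ * ‖y‖) * Q y)) := by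
          refine lintegral_mono fun y => ?_
          rw [← ENNReal.ofReal_mul (by positivity)]
          exact ENNReal.ofReal_le_ofReal (hpt y)
      _ ≤ _ := by
          rw [lintegral_const_mul' _ _ ENNReal.ofReal_ne_top]
          gcongr
          · exact le_rfl
          · exact lintegral_ofReal_mul_le (measurable_localSingularity N β)
              (localSingularity_nonneg N β) hQ
              (fun y => mul_nonneg (Real.exp_pos _).le (hQ0 y)) x

lemma measurable_sandwichedGreen (hQm : Measurable Q) (z : ℂ) :
    Measurable (Function.uncurry (sandwichedGreen Q z)) := by
  have h1 : Measurable fun u : Space N × Space N => green u.1 u.2 z :=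
    (measurable_greenRadial N z).comp measurable_dist
  unfold Function.uncurry sandwichedGreen
  fun_prop

lemma sandwichedGreen_comm (z : ℂ) (x y : Space N) :
    sandwichedGreen Q z x y = sandwichedGreen Q z y x := by
  simp only [sandwichedGreen, green, dist_comm x y]
  ring

lemma norm_sandwichedGreen_le {z : ℂ} {C : ℝ≥0} (hσ : 0 ≤ σ) {α : ℝ}
    (hC : ∀ r, 0 ≤ r → ‖greenRadial N z r‖ ≤ C * (Real.exp (σ * r) * (1 + r ^ (-α))))
    (x y : Space N) : ‖sandwichedGreen Q z x y‖ ≤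
      expWeight σ Q x * (C * (1 + dist x y ^ (-α))) * expWeight σ Q y := by
  have h1 := hC (dist x y) dist_nonneg
  have h2 : Real.exp (σ * dist x y) ≤ Real.exp (σ * ‖x‖) * Real.exp (σ * ‖y‖) := by
    rw [← Real.exp_add, ← mul_add]
    gcongr
    exact dist_le_norm_add_norm x y
  have h3 : ‖sandwichedGreen Q z x y‖ = √(Q x) * ‖greenRadial N z (dist x y)‖ * √(Q y) := by
    simp [sandwichedGreen, green, abs_of_nonneg, Real.sqrt_nonneg]
  rw [h3]
  calc _ ≤ √(Q x) * (C * ((Real.exp (σ * ‖x‖) * Real.exp (σ * ‖y‖)) * (1 + dist x y ^ (-α)))) *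
        √(Q y) := by
        gcongr
        exact h1.trans (by gcongr)
    _ = _ := by
        unfold expWeight
        ring

/-- A kernel dominated by `w(x) w(y)`, with `w` the square-integrable weight, is
Hilbert–Schmidt. -/
lemma isCompactOperator_of_norm_le_expWeight (hN : 1 ≤ N) [p.HolderConjugate p'] (hσ : 2 * σ < γ)
    (hQ0 : ∀ x, 0 ≤ Q x) (hQ : MemLp (fun x => Real.exp (γ * ‖x‖) * Q x) p)
    {k : Space N → Space N → ℂ} (hk : Measurable (Function.uncurry k)) {A : ℝ}
    (hle : ∀ x y, ‖k x y‖ ≤ A * (expWeight σ Q x * expWeight σ Q y))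
    {T : Lp ℂ 2 (volume : Measure (Space N)) →L[ℂ] Lp ℂ 2 (volume : Measure (Space N))}
    (hT : HasKernel T k) : IsCompactOperator T := by
  refine hT.isCompactOperator hk ?_
  set I := ∫⁻ x, ENNReal.ofReal (expWeight σ Q x ^ 2) with hI
  have hIt : I < ∞ := lintegral_expWeight_sq_lt_top (p' := p') hN hσ hQ0 hQ
  have h1 : ∀ x y, ‖k x y‖ₑ ^ 2 ≤ ENNReal.ofReal (A ^ 2 * expWeight σ Q x ^ 2) *
      ENNReal.ofReal (expWeight σ Q y ^ 2) := fun x y => by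
    rw [← ENNReal.ofReal_mul (by positivity), ← ofReal_norm, ← ENNReal.ofReal_pow (norm_nonneg _)]
    refine ENNReal.ofReal_le_ofReal ?_
    calc _ ≤ (A * (expWeight σ Q x * expWeight σ Q y)) ^ 2 := by
          gcongr
          exact hle x y
      _ = _ := by ring
  calc _ ≤ ∫⁻ x, ∫⁻ y, ENNReal.ofReal (A ^ 2 * expWeight σ Q x ^ 2) *
        ENNReal.ofReal (expWeight σ Q y ^ 2) := by
        gcongr with x y
        exact h1 x y
    _ = ENNReal.ofReal (A ^ 2) * I * I := by
        simp_rw [lintegral_const_mul' _ _ ENNReal.ofReal_ne_top, ← hI,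
          ENNReal.ofReal_mul (sq_nonneg A)]
        rw [lintegral_mul_const' _ _ hIt.ne, lintegral_const_mul' _ _ ENNReal.ofReal_ne_top]
    _ < ∞ := by finiteness

/-- Compactness of the sandwiched Green's operator: away from the diagonal its kernel is
Hilbert–Schmidt, and the part near the diagonal is small in norm. -/
lemma isCompactOperator_sandwichedGreen (hN : 1 ≤ N) [p.HolderConjugate p'] (hσ0 : 0 ≤ σ)
    (hσ : 2 * σ < γ) (hQm : Measurable Q) (hQ0 : ∀ x, 0 ≤ Q x)
    (hQ : MemLp (fun x => Real.exp (γ * ‖x‖) * Q x) p) {α : ℝ}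
    (hα : (N = 1 ∧ α = 0) ∨ (0 < α ∧ p' ≠ ∞ ∧ α * p'.toReal < N)) {z : ℂ} {C : ℝ≥0}
    (hC : ∀ r, 0 ≤ r → ‖greenRadial N z r‖ ≤ C * (Real.exp (σ * r) * (1 + r ^ (-α))))
    {T : Lp ℂ 2 (volume : Measure (Space N)) →L[ℂ] Lp ℂ 2 (volume : Measure (Space N))}
    (hT : HasKernel T (sandwichedGreen Q z)) : IsCompactOperator T := by
  have hle := norm_sandwichedGreen_le (Q := Q) hσ0 hC
  have hkm := measurable_sandwichedGreen hQm z
  rcases hα with ⟨-, rfl⟩ | ⟨hα0, hp', hαN⟩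
  · refine isCompactOperator_of_norm_le_expWeight (p' := p') (A := C * 2) hN hσ hQ0 hQ hkm
      (fun x y => (hle x y).trans_eq ?_) hT
    rw [neg_zero, Real.rpow_zero]
    ring
  have hp'0 : p' ≠ 0 := ENNReal.HolderConjugate.ne_zero p' p
  have ht : 0 < p'.toReal := ENNReal.toReal_pos hp'0 hp'
  -- a slightly stronger singularity is still in `L^{p'}`
  obtain ⟨β, hαβ, hβN⟩ : ∃ β, α < β ∧ β * p'.toReal < N := by
    obtain ⟨β, h1, h2⟩ := exists_between ((lt_div_iff₀ ht).mpr hαN)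
    exact ⟨β, h1, (lt_div_iff₀ ht).mp h2⟩
  have hα' := memLp_localSingularity hN hp'0 hp' hαN
  have hβ' := memLp_localSingularity hN hp'0 hp' hβN
  obtain ⟨M, hM⟩ := exists_schurBound (p' := p') hN hσ hQm hQ0 hQ hα0.le hα'
  -- the diagonal, a null set, is left in the far part: there `dist x y ^ (-α)` has the value `0`,
  -- so the bound on the kernel is harmless
  set kfar : ℕ → Space N → Space N → ℂ := fun n x y =>
    if 0 < dist x y ∧ dist x y < 1 / ((n : ℝ) + 1) then 0 else sandwichedGreen Q z x y with hkfar
  have hset : ∀ n : ℕ, MeasurableSet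
      {u : Space N × Space N | 0 < dist u.1 u.2 ∧ dist u.1 u.2 < 1 / ((n : ℝ) + 1)} := fun n =>
    (measurableSet_lt measurable_const measurable_dist).inter
      (measurableSet_lt measurable_dist measurable_const)
  have hfm : ∀ n, Measurable (Function.uncurry (kfar n)) := fun n =>
    Measurable.ite (hset n) measurable_const hkm
  have hfle : ∀ n x y, ‖kfar n x y‖ ≤
      expWeight σ Q x * (C * (1 + dist x y ^ (-α))) * expWeight σ Q y := fun n x y => by
    simp only [hkfar]
    split_ifs
    · rw [norm_zero]
      exact (norm_nonneg _).trans (hle x y)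
    · exact hle x y
  have hex := fun n => (hM.const_mul C).exists_hasKernel (hfm n) (hfle n)
  choose F hF _ using hex
  have hFc : ∀ n, IsCompactOperator (F n) := fun n => by
    set η : ℝ := 1 / ((n : ℝ) + 1) with hη
    have hη0 : 0 < η := by positivity
    refine isCompactOperator_of_norm_le_expWeight (p' := p') (A := C * (1 + η ^ (-α))) hN hσ hQ0 hQ
      (hfm n) (fun x y => ?_) (hF n)
    have hw := expWeight_nonneg (σ := σ) (Q := Q)
    have hwx := hw x
    have hwy := hw y
    simp only [hkfar]
    split_ifs with h
    · rw [norm_zero]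
      positivity
    · have h5 : dist x y ^ (-α) ≤ η ^ (-α) := by
        rcases (dist_nonneg (x := x) (y := y)).eq_or_lt with h0 | h0
        · rw [← h0, Real.zero_rpow (by linarith)]
          positivity
        · exact Real.rpow_le_rpow_of_nonpos hη0 (not_lt.mp fun h' => h ⟨h0, h'⟩) (by linarith)
      calc _ ≤ _ := hle x y
        _ ≤ expWeight σ Q x * (C * (1 + η ^ (-α))) * expWeight σ Q y := by gcongr
        _ = _ := by ring
  have hdiff : ∀ n : ℕ, ‖F n - T‖ ≤ C * ((2 * (1 / ((n : ℝ) + 1)) ^ (β - α)) *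
      (eLpNorm (localSingularity N β) p' *
        eLpNorm (fun x => Real.exp (γ * ‖x‖) * Q x) p).toReal) := fun n => by
    have hη1 : 1 / ((n : ℝ) + 1) ≤ 1 := by
      rw [div_le_one (by positivity)]
      linarith [Nat.cast_nonneg (α := ℝ) n]
    have hs := (schurBound_near hσ hQm hQ0 hQ hα0.le hαβ.le hβ'
      (show 0 < 1 / ((n : ℝ) + 1) by positivity) hη1).const_mul C
    have hm : Measurable (Function.uncurry fun x y => sandwichedGreen Q z x y - kfar n x y) :=
      hkm.sub (hfm n)
    rw [norm_sub_rev]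
    refine (hs.norm_le_of_hasKernel hm (fun x y => ?_) (hT.sub (hF n))).trans_eq ?_
    · simp only [hkfar]
      split_ifs
      · rw [sub_zero]
        exact hle x y
      · simp
    · rw [NNReal.coe_mul, NNReal.coe_mul, Real.coe_toNNReal _ (by positivity)]
      rfl
  refine isCompactOperator_of_tendsto (l := atTop) (F := F) ?_ (Eventually.of_forall hFc)
  rw [tendsto_iff_norm_sub_tendsto_zero]
  refine squeeze_zero (fun _ => norm_nonneg _) hdiff ?_
  have h1 : Tendsto (fun n : ℕ => (1 / ((n : ℝ) + 1)) ^ (β - α)) atTop (𝓝 0) := by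
    have := tendsto_one_div_add_atTop_nhds_zero_nat (𝕜 := ℝ) |>.rpow_const
      (p := β - α) (Or.inr (by linarith))
    rwa [Real.zero_rpow (by linarith)] at this
  simpa using ((h1.const_mul 2).mul_const _).const_mul (C : ℝ)

/-- The sandwiched Green's operators `Q^(1/2) (-Δ + z²)⁻¹ Q^(1/2)` form, near every `z₀` of the
sheet with `Re z₀ > -γ/2`, a holomorphic family of compact symmetric operators on `L²`. -/
theorem exists_sandwichedGreen_family (hN : 1 ≤ N) (hγ : 0 < γ) (hp1 : 1 ≤ p)
    (hpN : (N : ℝ≥0∞) / 2 < p) (hQm : Measurable Q) (hQ0 : ∀ x, 0 ≤ Q x)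
    (hQ : MemLp (fun x => Real.exp (γ * ‖x‖) * Q x) p) {z₀ : ℂ} (hz₀ : z₀ ∈ sheet N)
    (hz₀γ : -(γ / 2) < z₀.re) :
    ∃ (K : ℂ → Lp ℂ 2 (volume : Measure (Space N)) →L[ℂ] Lp ℂ 2 (volume : Measure (Space N)))
      (ρ : ℝ), 0 < ρ ∧ Metric.ball z₀ ρ ⊆ sheet N ∧
      (∀ z ∈ Metric.ball z₀ ρ, HasKernel (K z) (sandwichedGreen Q z)) ∧ AnalyticAt ℂ K z₀ ∧
      HasKernel (deriv K z₀) (fun x y => deriv (fun z => sandwichedGreen Q z x y) z₀) ∧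
      IsCompactOperator (K z₀) ∧
      ∀ f g : Lp ℂ 2 (volume : Measure (Space N)), ∫ x, K z₀ f x * g x = ∫ x, f x * K z₀ g x := by
  set p' := p.conjExponent
  have : p.HolderConjugate p' := ENNReal.HolderConjugate.conjExponent hp1
  obtain ⟨σ, hσ1, hσ2⟩ : ∃ σ, max 0 (-z₀.re) < σ ∧ σ < γ / 2 :=
    exists_between (max_lt (by linarith) (by linarith))
  have hσ0 : 0 ≤ σ := (le_max_left _ _).trans hσ1.le
  have hσz : -z₀.re < σ := (le_max_right _ _).trans_lt hσ1
  have hσγ : 2 * σ < γ := by linarith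
  obtain ⟨α, hαadm, hα⟩ := exists_admissibleExponent (p' := p') hN hpN
  obtain ⟨ρ, hρ, C, hsheet, hG⟩ := exists_greenRadial_bound hz₀ hσz hαadm
  have hα' : 0 ≤ α ∧ MemLp (localSingularity N α) p' := by
    rcases hα with ⟨-, rfl⟩ | ⟨h0, h1, h2⟩
    · exact ⟨le_rfl, memLp_localSingularity_zero N p'⟩
    · exact ⟨h0.le, memLp_localSingularity hN (ENNReal.HolderConjugate.ne_zero p' p) h1 h2⟩
  obtain ⟨M, hM⟩ := exists_schurBound (p' := p') hN hσγ hQm hQ0 hQ hα'.1 hα'.2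
  have hbound : ∀ z ∈ Metric.ball z₀ ρ, ∀ r, 0 ≤ r →
      ‖greenRadial N z r‖ ≤ C * (Real.exp (σ * r) * (1 + r ^ (-α))) := fun z hz r hr =>
    (hG r hr).2 z hz
  have hle : ∀ z ∈ Metric.ball z₀ ρ, ∀ x y, ‖sandwichedGreen Q z x y‖ ≤
      expWeight σ Q x * (C * (1 + dist x y ^ (-α))) * expWeight σ Q y := fun z hz =>
    norm_sandwichedGreen_le hσ0 (hbound z hz)
  obtain ⟨K, hK, hKan, hKd⟩ := (hM.const_mul C).exists_holomorphic_family hρ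
    (k := sandwichedGreen Q) (fun z _ => measurable_sandwichedGreen hQm z)
    (fun x y => (((hG (dist x y) dist_nonneg).1.const_mul (√(Q x) : ℂ)).mul_const
      (√(Q y) : ℂ))) hle
  have hz₀ρ := Metric.mem_ball_self (x := z₀) hρ
  refine ⟨K, ρ, hρ, hsheet, hK, hKan, hKd, ?_, ?_⟩
  · exact isCompactOperator_sandwichedGreen (p' := p') hN hσ0 hσγ hQm hQ0 hQ hα
      (hbound z₀ hz₀ρ) (hK z₀ hz₀ρ)
  · exact (hM.const_mul C).integral_mul_comm (measurable_sandwichedGreen hQm z₀) (hle z₀ hz₀ρ)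
      (sandwichedGreen_comm z₀) (hK z₀ hz₀ρ)

end WeightedKernels

/-! ### Multiplication operators and the bilinear pairing -/

section Multiplication

variable {α : Type*} [MeasurableSpace α] {μ : Measure α}

lemma exists_mulOp {a : α → ℝ} (ha : Measurable a) (hb : ∀ x, |a x| ≤ 1) :
    ∃ T : Lp ℂ 2 μ →L[ℂ] Lp ℂ 2 μ, ∀ f : Lp ℂ 2 μ, T f =ᵐ[μ] fun x => (a x : ℂ) * f x := by
  have hm : MemLp (fun x => (a x : ℂ)) ∞ μ := memLp_top_of_bound
    (Complex.measurable_ofReal.comp ha).aestronglyMeasurable 1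
    (Eventually.of_forall fun x => by simpa using hb x)
  refine ⟨(ContinuousLinearMap.mul ℂ ℂ).holderL μ ∞ 2 2 hm.toLp, fun f => ?_⟩
  filter_upwards [(ContinuousLinearMap.mul ℂ ℂ).coeFn_holder (r := 2) hm.toLp f, hm.coeFn_toLp]
    with x h1 h2
  rw [ContinuousLinearMap.holderL_apply_apply, h1, h2]
  rfl

open Classical in
/-- Multiplication by the real function `a` on `L²(μ)`, for measurable `a` with `|a| ≤ 1`
(and zero if there is no such bounded operator). -/
noncomputable def mulOp (μ : Measure α) (a : α → ℝ) : Lp ℂ 2 μ →L[ℂ] Lp ℂ 2 μ :=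
  if h : ∃ T : Lp ℂ 2 μ →L[ℂ] Lp ℂ 2 μ, ∀ f : Lp ℂ 2 μ, T f =ᵐ[μ] fun x => (a x : ℂ) * f x then
    h.choose else 0

lemma coeFn_mulOp {a : α → ℝ} (ha : Measurable a) (hb : ∀ x, |a x| ≤ 1) (f : Lp ℂ 2 μ) :
    mulOp μ a f =ᵐ[μ] fun x => (a x : ℂ) * f x := by
  rw [mulOp, dif_pos (exists_mulOp ha hb)]
  exact (exists_mulOp ha hb).choose_spec f

lemma integral_mulOp_mul_comm {a : α → ℝ} (ha : Measurable a) (hb : ∀ x, |a x| ≤ 1)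
    (f g : Lp ℂ 2 μ) : ∫ x, mulOp μ a f x * g x ∂μ = ∫ x, f x * mulOp μ a g x ∂μ := by
  refine integral_congr_ae ?_
  filter_upwards [coeFn_mulOp ha hb f, coeFn_mulOp ha hb g] with x h1 h2
  rw [h1, h2]
  ring

/-- The bilinear pairing `f ↦ ∫ f g` with a fixed `g ∈ L²`. -/
noncomputable def pairingWith (g : Lp ℂ 2 μ) : Lp ℂ 2 μ →L[ℂ] ℂ :=
  ((ContinuousLinearMap.mul ℂ ℂ).lpPairing μ 2 2).flip g

lemma pairingWith_apply (f g : Lp ℂ 2 μ) : pairingWith g f = ∫ x, f x * g x ∂μ := by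
  rw [pairingWith, ContinuousLinearMap.flip_apply, ContinuousLinearMap.lpPairing_eq_integral]
  rfl

end Multiplication

section WeightedIntegrals

variable {α : Type*} [MeasurableSpace α] {μ : Measure α} {T : Lp ℂ 2 μ →L[ℂ] Lp ℂ 2 μ}
  {s : α → ℝ} {G : α → α → ℂ}

lemma HasKernel.integrable_weighted (hT : HasKernel T fun x y => (s x : ℂ) * G x y * (s y : ℂ))
    {L R : α → ℝ} {l g : α → ℂ} {h : Lp ℂ 2 μ} (hL : ∀ x, (L x : ℂ) = l x * s x)
    (hR : ∀ᵐ y ∂μ, (R y : ℂ) * g y = s y * h y) :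
    ∀ᵐ x ∂μ, Integrable (fun y => (L x : ℂ) * G x y * (R y : ℂ) * g y) μ := by
  filter_upwards [(hT h).1] with x hx
  refine (hx.const_mul (l x)).congr ?_
  filter_upwards [hR] with y hy
  rw [mul_assoc _ (R y : ℂ), hy, hL]
  ring

lemma HasKernel.mul_integral_weighted
    (hT : HasKernel T fun x y => (s x : ℂ) * G x y * (s y : ℂ))
    {L R : α → ℝ} {u v g : α → ℂ} {h : Lp ℂ 2 μ} (hL : ∀ᵐ x ∂μ, (L x : ℂ) * u x = s x * v x)
    (hR : ∀ᵐ y ∂μ, (R y : ℂ) * g y = s y * h y) :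
    ∀ᵐ x ∂μ, (∫ y, (L x : ℂ) * G x y * (R y : ℂ) * g y ∂μ) * u x = v x * T h x := by
  filter_upwards [(hT h).2, hL] with x hx hLx
  rw [hx, ← integral_const_mul, ← integral_mul_const]
  refine integral_congr_ae ?_
  filter_upwards [hR] with y hy
  calc _ = ((L x : ℂ) * u x) * G x y * ((R y : ℂ) * g y) := by ring
    _ = _ := by
      rw [hLx, hy]
      ring

end WeightedIntegrals

/-! ### Factorization of the Birman–Schwinger operator -/

section Factorization

/-- The square root `|a|^(1/2)` of a relative potential `a = U / Q`. -/
noncomputable def relRoot (a : ℝ) : ℝ := √|a|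

/-- The signed square root `a / |a|^(1/2)` of a relative potential `a = U / Q`. -/
noncomputable def relSignedRoot (a : ℝ) : ℝ := a / √|a|

lemma measurable_relRoot : Measurable relRoot := by
  unfold relRoot
  fun_prop

lemma measurable_relSignedRoot : Measurable relSignedRoot := by
  unfold relSignedRoot
  fun_prop

lemma abs_relRoot_le {a : ℝ} (ha : |a| ≤ 1) : |relRoot a| ≤ 1 := by
  rw [relRoot, abs_of_nonneg (Real.sqrt_nonneg _)]
  exact Real.sqrt_le_one.mpr ha

lemma abs_relSignedRoot_le {a : ℝ} (ha : |a| ≤ 1) : |relSignedRoot a| ≤ 1 := by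
  rw [relSignedRoot, abs_div, abs_of_nonneg (Real.sqrt_nonneg _), Real.div_sqrt]
  exact Real.sqrt_le_one.mpr ha

lemma relSignedRoot_mul_relRoot (a : ℝ) : relSignedRoot a * relRoot a = a := by
  rw [relSignedRoot, relRoot]
  refine div_mul_cancel_of_imp fun h => ?_
  rwa [Real.sqrt_eq_zero (abs_nonneg a), abs_eq_zero] at h

lemma relSignedRoot_of_nonneg {a : ℝ} (ha : 0 ≤ a) : relSignedRoot a = relRoot a := by
  rw [relSignedRoot, relRoot, abs_of_nonneg ha, Real.div_sqrt]

/-- The square root is not Lipschitz at zero, but this difference is only needed multiplied by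
`relRoot a`. -/
lemma abs_relRoot_sub_mul_le (a a' : ℝ) :
    |(relRoot a' - relRoot a) * relRoot a| ≤ |a' - a| := by
  have h1 : 0 ≤ relRoot a := Real.sqrt_nonneg _
  have h2 : 0 ≤ relRoot a' := Real.sqrt_nonneg _
  calc |(relRoot a' - relRoot a) * relRoot a| = |relRoot a' - relRoot a| * relRoot a := by
        rw [abs_mul, abs_of_nonneg h1]
    _ ≤ |relRoot a' - relRoot a| * (relRoot a' + relRoot a) := by gcongr; linarith
    _ = |(relRoot a' - relRoot a) * (relRoot a' + relRoot a)| := by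
        rw [abs_mul, abs_of_nonneg (add_nonneg h2 h1)]
    _ = |(|a'| - |a|)| := by
        congr 1
        simp only [relRoot]
        linear_combination Real.sq_sqrt (abs_nonneg a') - Real.sq_sqrt (abs_nonneg a)
    _ ≤ _ := abs_abs_sub_abs_le _ _

variable {N : ℕ} {U Q a : Space N → ℝ}

lemma absRoot_eq (hQ0 : ∀ x, 0 ≤ Q x) (hU : ∀ x, U x = a x * Q x) (x : Space N) :
    absRoot U x = relRoot (a x) * √(Q x) := by
  rw [absRoot, relRoot, hU, abs_mul, abs_of_nonneg (hQ0 x), Real.sqrt_mul (abs_nonneg _)]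

lemma signedRoot_eq (hQ0 : ∀ x, 0 ≤ Q x) (hU : ∀ x, U x = a x * Q x) (x : Space N) :
    signedRoot U x = relSignedRoot (a x) * √(Q x) := by
  rw [signedRoot, absRoot_eq hQ0 hU, relSignedRoot, relRoot, hU, mul_div_mul_comm, Real.div_sqrt]

variable {K : Lp ℂ 2 (volume : Measure (Space N)) →L[ℂ] Lp ℂ 2 (volume : Measure (Space N))}
  {z : ℂ}

/-- Factoring `Q^(1/2)` out of the Birman–Schwinger operator of `U = a Q`. -/
lemma inKernel_iff (ha : Measurable a) (ha1 : ∀ x, |a x| ≤ 1) (hQ0 : ∀ x, 0 ≤ Q x)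
    (hU : ∀ x, U x = a x * Q x) (hK : HasKernel K (sandwichedGreen Q z))
    (g : Lp ℂ 2 (volume : Measure (Space N))) :
    InKernel U z g ↔
      mulOp volume (relSignedRoot ∘ a) (K (mulOp volume (relRoot ∘ a) g)) + g = 0 := by
  have hb := coeFn_mulOp (μ := (volume : Measure (Space N))) (measurable_relRoot.comp ha)
    (fun x => abs_relRoot_le (ha1 x)) g
  have hc := coeFn_mulOp (μ := (volume : Measure (Space N))) (measurable_relSignedRoot.comp ha)
    (fun x => abs_relSignedRoot_le (ha1 x)) (K (mulOp volume (relRoot ∘ a) g))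
  have hL : ∀ x, (signedRoot U x : ℂ) = (relSignedRoot (a x) : ℂ) * (√(Q x) : ℂ) := fun x => by
    rw [signedRoot_eq hQ0 hU]
    push_cast
    rfl
  have hR : ∀ᵐ y, (absRoot U y : ℂ) * g y = (√(Q y) : ℂ) * mulOp volume (relRoot ∘ a) g y := by
    filter_upwards [hb] with y hy
    rw [hy, absRoot_eq hQ0 hU]
    push_cast
    simp only [Function.comp_apply]
    ring
  have h1 := hK.integrable_weighted (G := fun x y => green x y z) hL hR
  have h2 := hK.mul_integral_weighted (G := fun x y => green x y z) (u := fun _ => 1)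
    (v := fun x => (relSignedRoot (a x) : ℂ)) (L := signedRoot U)
    (Eventually.of_forall fun x => by rw [hL, mul_one, mul_comm]) hR
  have h3 : ∀ᵐ x, opA U z g x =
      (mulOp volume (relSignedRoot ∘ a) (K (mulOp volume (relRoot ∘ a) g)) + g :
        Lp ℂ 2 (volume : Measure (Space N))) x := by
    filter_upwards [h2, hc, Lp.coeFn_add
      (mulOp volume (relSignedRoot ∘ a) (K (mulOp volume (relRoot ∘ a) g))) g] with x h4 h5 h6
    rw [h6, Pi.add_apply, h5, opA]
    rw [mul_one] at h4
    rw [h4]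
    rfl
  rw [InKernel, and_iff_right h1, Lp.eq_zero_iff_ae_eq_zero]
  constructor
  · intro h
    filter_upwards [h, h3] with x h4 h5
    rw [← h5, h4]
    rfl
  · intro h
    filter_upwards [h, h3] with x h4 h5
    rw [h5, h4]
    rfl

lemma mulOp_relRoot_mulOp_relSignedRoot (ha : Measurable a) (ha1 : ∀ x, |a x| ≤ 1)
    (f : Lp ℂ 2 (volume : Measure (Space N))) :
    mulOp volume (relRoot ∘ a) (mulOp volume (relSignedRoot ∘ a) f) = mulOp volume a f := by
  refine Lp.ext ?_
  filter_upwards [coeFn_mulOp (measurable_relRoot.comp ha) (fun x => abs_relRoot_le (ha1 x))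
      (mulOp volume (relSignedRoot ∘ a) f),
    coeFn_mulOp (measurable_relSignedRoot.comp ha) (fun x => abs_relSignedRoot_le (ha1 x)) f,
    coeFn_mulOp ha ha1 f] with x h1 h2 h3
  rw [h1, h2, h3, ← mul_assoc]
  congr 1
  rw [mul_comm]
  exact_mod_cast relSignedRoot_mul_relRoot (a x)

/-- From a solution `g` of the Birman–Schwinger equation, `f = K |a|^(1/2) g` solves
`f + K a f = 0`, and `g` is recovered from `f`. -/
lemma InKernel.spec (ha : Measurable a) (ha1 : ∀ x, |a x| ≤ 1) (hQ0 : ∀ x, 0 ≤ Q x)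
    (hU : ∀ x, U x = a x * Q x) (hK : HasKernel K (sandwichedGreen Q z))
    {g : Lp ℂ 2 (volume : Measure (Space N))} (hg : InKernel U z g) :
    K (mulOp volume (relRoot ∘ a) g) + K (mulOp volume a (K (mulOp volume (relRoot ∘ a) g))) = 0 ∧
      g = -mulOp volume (relSignedRoot ∘ a) (K (mulOp volume (relRoot ∘ a) g)) := by
  rw [inKernel_iff ha ha1 hQ0 hU hK] at hg
  have h1 : g = -mulOp volume (relSignedRoot ∘ a) (K (mulOp volume (relRoot ∘ a) g)) :=
    eq_neg_of_add_eq_zero_right hg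
  refine ⟨?_, h1⟩
  have h2 : mulOp volume (relRoot ∘ a) g = -mulOp volume a (K (mulOp volume (relRoot ∘ a) g)) := by
    conv_lhs => rw [h1]
    rw [map_neg, mulOp_relRoot_mulOp_relSignedRoot ha ha1]
  conv_lhs => enter [1]; rw [h2, map_neg]
  exact neg_add_cancel _

/-- Conversely, a solution of `f + K a f = 0` gives a solution of the Birman–Schwinger
equation. -/
lemma inKernel_of_add_eq_zero (ha : Measurable a) (ha1 : ∀ x, |a x| ≤ 1) (hQ0 : ∀ x, 0 ≤ Q x)
    (hU : ∀ x, U x = a x * Q x) (hK : HasKernel K (sandwichedGreen Q z))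
    {f : Lp ℂ 2 (volume : Measure (Space N))} (hf : f + K (mulOp volume a f) = 0) :
    InKernel U z (-mulOp volume (relSignedRoot ∘ a) f) ∧
      K (mulOp volume (relRoot ∘ a) (-mulOp volume (relSignedRoot ∘ a) f)) = f := by
  have h1 : K (mulOp volume (relRoot ∘ a) (-mulOp volume (relSignedRoot ∘ a) f)) = f := by
    rw [map_neg, map_neg, mulOp_relRoot_mulOp_relSignedRoot ha ha1]
    exact (eq_neg_of_add_eq_zero_left hf).symm
  refine ⟨?_, h1⟩
  rw [inKernel_iff ha ha1 hQ0 hU hK, h1]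
  exact add_neg_cancel _

lemma isResonanceAt_iff (ha : Measurable a) (ha1 : ∀ x, |a x| ≤ 1) (hQ0 : ∀ x, 0 ≤ Q x)
    (hU : ∀ x, U x = a x * Q x) (hz : z ∈ sheet N) (hK : HasKernel K (sandwichedGreen Q z)) :
    IsResonanceAt U z ↔ ∃ f ≠ 0, f + K (mulOp volume a f) = 0 := by
  constructor
  · rintro ⟨-, g, hg0, hg⟩
    obtain ⟨h1, h2⟩ := hg.spec ha ha1 hQ0 hU hK
    refine ⟨_, fun h0 => hg0 ?_, h1⟩
    rw [h2, h0, map_zero, neg_zero]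
  · rintro ⟨f, hf0, hf⟩
    obtain ⟨h1, h2⟩ := inKernel_of_add_eq_zero ha ha1 hQ0 hU hK hf
    refine ⟨hz, _, fun h0 => hf0 ?_, h1⟩
    rw [← h2, h0, map_zero, map_zero]

end Factorization

/-! ### The relative potential -/

section RelativePotential

variable {N : ℕ} {V V₁ : Space N → ℝ}

/-- The common majorant `Q = V + |V₁|` of the potential and its perturbation. -/
def majorant (V V₁ : Space N → ℝ) (x : Space N) : ℝ := V x + |V₁ x|

/-- The relative potential `(V + ε V₁) / Q` with respect to the majorant `Q`; it is affine in `ε`,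
and bounded by one for `|ε| ≤ 1`. -/
noncomputable def relPotential (V V₁ : Space N → ℝ) (ε : ℝ) (x : Space N) : ℝ :=
  (V x + ε * V₁ x) / majorant V V₁ x

/-- The relative perturbation `V₁ / Q`. -/
noncomputable def relPerturbation (V V₁ : Space N → ℝ) (x : Space N) : ℝ :=
  V₁ x / majorant V V₁ x

lemma measurable_majorant (hV : Measurable V) (hV₁ : Measurable V₁) :
    Measurable (majorant V V₁) := by
  unfold majorant
  fun_prop

lemma majorant_nonneg (hVpos : ∀ x, 0 ≤ V x) (x : Space N) : 0 ≤ majorant V V₁ x :=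
  add_nonneg (hVpos x) (abs_nonneg _)

lemma measurable_relPotential (hV : Measurable V) (hV₁ : Measurable V₁) (ε : ℝ) :
    Measurable (relPotential V V₁ ε) := by
  have := measurable_majorant hV hV₁
  unfold relPotential
  fun_prop

lemma measurable_relPerturbation (hV : Measurable V) (hV₁ : Measurable V₁) :
    Measurable (relPerturbation V V₁) := by
  have := measurable_majorant hV hV₁
  unfold relPerturbation
  fun_prop

lemma abs_relPotential_le (hVpos : ∀ x, 0 ≤ V x) {ε : ℝ} (hε : |ε| ≤ 1) (x : Space N) :
    |relPotential V V₁ ε x| ≤ 1 := by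
  rw [relPotential, abs_div, abs_of_nonneg (majorant_nonneg hVpos x)]
  refine div_le_one_of_le₀ ?_ (majorant_nonneg hVpos x)
  calc |V x + ε * V₁ x| ≤ |V x| + |ε * V₁ x| := abs_add_le _ _
    _ ≤ V x + 1 * |V₁ x| := by
        rw [abs_of_nonneg (hVpos x), abs_mul]
        gcongr
    _ = majorant V V₁ x := by rw [one_mul, majorant]

lemma abs_relPerturbation_le (hVpos : ∀ x, 0 ≤ V x) (x : Space N) :
    |relPerturbation V V₁ x| ≤ 1 := by
  rw [relPerturbation, abs_div, abs_of_nonneg (majorant_nonneg hVpos x)]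
  refine div_le_one_of_le₀ ?_ (majorant_nonneg hVpos x)
  rw [majorant]
  linarith [hVpos x]

lemma relPotential_zero_nonneg (hVpos : ∀ x, 0 ≤ V x) (x : Space N) :
    0 ≤ relPotential V V₁ 0 x :=
  div_nonneg (by simpa using hVpos x) (majorant_nonneg hVpos x)

lemma relPotential_mul_majorant (hVpos : ∀ x, 0 ≤ V x) (ε : ℝ) (x : Space N) :
    V x + ε * V₁ x = relPotential V V₁ ε x * majorant V V₁ x := by
  rw [relPotential]
  refine (div_mul_cancel_of_imp fun h => ?_).symm
  rw [majorant] at h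
  have h1 : |V₁ x| = 0 := by linarith [hVpos x, abs_nonneg (V₁ x)]
  have h2 : V x = 0 := by linarith
  rw [h2, abs_eq_zero.mp h1]
  ring

lemma relPotential_eq (ε : ℝ) (x : Space N) :
    relPotential V V₁ ε x = relPotential V V₁ 0 x + ε * relPerturbation V V₁ x := by
  rw [relPotential, relPotential, relPerturbation]
  ring

lemma mulOp_relPotential (hV : Measurable V) (hV₁ : Measurable V₁) (hVpos : ∀ x, 0 ≤ V x)
    {ε : ℝ} (hε : |ε| ≤ 1) (f : Lp ℂ 2 (volume : Measure (Space N))) :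
    mulOp volume (relPotential V V₁ ε) f = mulOp volume (relPotential V V₁ 0) f +
      (ε : ℂ) • mulOp volume (relPerturbation V V₁) f := by
  refine Lp.ext ?_
  filter_upwards [coeFn_mulOp (μ := (volume : Measure (Space N)))
      (measurable_relPotential hV hV₁ ε) (abs_relPotential_le hVpos hε) f,
    coeFn_mulOp (μ := (volume : Measure (Space N))) (measurable_relPotential hV hV₁ 0)
      (abs_relPotential_le hVpos (by simp)) f,
    coeFn_mulOp (μ := (volume : Measure (Space N))) (measurable_relPerturbation hV hV₁)
      (abs_relPerturbation_le hVpos) f,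
    Lp.coeFn_add (mulOp volume (relPotential V V₁ 0) f)
      ((ε : ℂ) • mulOp volume (relPerturbation V V₁) f),
    Lp.coeFn_smul (ε : ℂ) (mulOp volume (relPerturbation V V₁) f)] with x h1 h2 h3 h4 h5
  rw [h4, Pi.add_apply, h5, Pi.smul_apply, h1, h2, h3, relPotential_eq]
  push_cast
  rw [smul_eq_mul]
  ring

/-- In terms of the relative potential, the vector `V₁ / (2 V^(1/2)) g₀` is well behaved, although
`V₁ / (2 V^(1/2))` need not be: `g₀` carries a factor `V^(1/2)`. This uses that `V₁` vanishes
where `V` does. -/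
lemma rootVariation_mul_relRoot (hVpos : ∀ x, 0 ≤ V x) (hV₁supp : ∀ x, V x = 0 → V₁ x = 0)
    (x : Space N) : rootVariation V V₁ x * relRoot (relPotential V V₁ 0 x) =
      √(majorant V V₁ x) * (relPerturbation V V₁ x / 2) := by
  rcases (hVpos x).eq_or_lt with h | h
  · simp [rootVariation, relPerturbation, hV₁supp x h.symm]
  · have hQ : 0 < majorant V V₁ x := add_pos_of_pos_of_nonneg h (abs_nonneg _)
    have ha : relPotential V V₁ 0 x = V x / majorant V V₁ x := by simp [relPotential]
    have hs := Real.sqrt_pos.mpr hQ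
    have hv := Real.sqrt_pos.mpr h
    rw [rootVariation, relPerturbation, relRoot, ha, abs_of_nonneg (by positivity),
      Real.sqrt_div h.le]
    have := Real.mul_self_sqrt hQ.le
    field_simp
    rw [Real.sq_sqrt hQ.le]

lemma memLp_exp_mul_majorant {γ : ℝ} {p : ℝ≥0∞}
    (hVdecay : MemLp (fun x => Real.exp (γ * ‖x‖) * V x) p)
    (hV₁decay : MemLp (fun x => Real.exp (γ * ‖x‖) * V₁ x) p) :
    MemLp (fun x => Real.exp (γ * ‖x‖) * majorant V V₁ x) p := by
  convert hVdecay.add hV₁decay.norm using 1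
  funext x
  simp only [Pi.add_apply, majorant, Real.norm_eq_abs, abs_mul, Real.abs_exp]
  ring

end RelativePotential

/-! ### The pairings in the coefficient -/

section Pairings

variable {N : ℕ} {V V₁ : Space N → ℝ}
  {K K' : Lp ℂ 2 (volume : Measure (Space N)) →L[ℂ] Lp ℂ 2 (volume : Measure (Space N))} {z : ℂ}
  {g f : Lp ℂ 2 (volume : Measure (Space N))}

/-- The relations between the solution `g = -V^(1/2) u` of the Birman–Schwinger equation and the
vector `f = Q^(1/2) u`. -/
lemma weighted_relations (hV : Measurable V) (hV₁ : Measurable V₁) (hVpos : ∀ x, 0 ≤ V x)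
    (hV₁supp : ∀ x, V x = 0 → V₁ x = 0)
    (hg : g = -mulOp volume (relSignedRoot ∘ relPotential V V₁ 0) f) :
    (∀ᵐ x, (absRoot V x : ℂ) * g x =
      (√(majorant V V₁ x) : ℂ) * (-mulOp volume (relPotential V V₁ 0) f : Lp ℂ 2 _) x) ∧
    (∀ᵐ x, (signedRoot V x : ℂ) * g x =
      (√(majorant V V₁ x) : ℂ) * (-mulOp volume (relPotential V V₁ 0) f : Lp ℂ 2 _) x) ∧
    (∀ᵐ x, (rootVariation V V₁ x : ℂ) * g x =
      (√(majorant V V₁ x) : ℂ) *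
        ((-(1 / 2) : ℂ) • mulOp volume (relPerturbation V V₁) f : Lp ℂ 2 _) x) := by
  have hQ0 := majorant_nonneg (V₁ := V₁) hVpos
  have hU : ∀ x, V x = relPotential V V₁ 0 x * majorant V V₁ x := fun x => by
    simpa using relPotential_mul_majorant (V₁ := V₁) hVpos 0 x
  have ha := measurable_relPotential hV hV₁ 0
  have ha1 := abs_relPotential_le (V₁ := V₁) hVpos (ε := 0) (by simp)
  have hroot : ∀ x, relSignedRoot (relPotential V V₁ 0 x) = relRoot (relPotential V V₁ 0 x) :=
    fun x => relSignedRoot_of_nonneg (relPotential_zero_nonneg hVpos x)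
  have hgx : ∀ᵐ x, g x = -((relRoot (relPotential V V₁ 0 x) : ℂ) * f x) := by
    filter_upwards [coeFn_mulOp (μ := (volume : Measure (Space N)))
      (measurable_relSignedRoot.comp ha) (fun x => abs_relSignedRoot_le (ha1 x)) f,
      Lp.coeFn_neg (mulOp volume (relSignedRoot ∘ relPotential V V₁ 0) f)] with x h1 h2
    rw [hg, h2, Pi.neg_apply, h1, Function.comp_apply, hroot]
  have hM0 : ∀ᵐ x, (-mulOp volume (relPotential V V₁ 0) f : Lp ℂ 2 _) x =
      -((relPotential V V₁ 0 x : ℂ) * f x) := by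
    filter_upwards [coeFn_mulOp (μ := (volume : Measure (Space N))) ha ha1 f,
      Lp.coeFn_neg (mulOp volume (relPotential V V₁ 0) f)] with x h1 h2
    rw [h2, Pi.neg_apply, h1]
  have hsq : ∀ x, ((relRoot (relPotential V V₁ 0 x) : ℂ)) * (relRoot (relPotential V V₁ 0 x) : ℂ)
      = relPotential V V₁ 0 x := fun x => by
    have := relSignedRoot_mul_relRoot (relPotential V V₁ 0 x)
    rw [hroot] at this
    exact_mod_cast this
  have habs : ∀ᵐ x, (absRoot V x : ℂ) * g x =
      (√(majorant V V₁ x) : ℂ) * (-mulOp volume (relPotential V V₁ 0) f : Lp ℂ 2 _) x := by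
    filter_upwards [hgx, hM0] with x h1 h2
    rw [h1, h2, absRoot_eq hQ0 hU, ← hsq]
    push_cast
    ring
  refine ⟨habs, ?_, ?_⟩
  · have : ∀ x, signedRoot V x = absRoot V x := fun x => by
      rw [signedRoot_eq hQ0 hU, absRoot_eq hQ0 hU, hroot]
    simp only [this]
    exact habs
  · filter_upwards [hgx, coeFn_mulOp (μ := (volume : Measure (Space N)))
      (measurable_relPerturbation hV hV₁) (abs_relPerturbation_le hVpos) f,
      Lp.coeFn_smul (-(1 / 2) : ℂ) (mulOp volume (relPerturbation V V₁) f)] with x h1 h2 h3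
    rw [h1, h3, Pi.smul_apply, h2, smul_eq_mul]
    have h4 : (rootVariation V V₁ x : ℂ) * (relRoot (relPotential V V₁ 0 x) : ℂ) =
        (√(majorant V V₁ x) : ℂ) * ((relPerturbation V V₁ x : ℂ) / 2) := by
      exact_mod_cast rootVariation_mul_relRoot hVpos hV₁supp x
    linear_combination (-f x) * h4

/-- `(A'(z) g, g)` in terms of the symmetrized operators. -/
lemma pairing_opA'_eq (hV : Measurable V) (hV₁ : Measurable V₁) (hVpos : ∀ x, 0 ≤ V x)
    (hV₁supp : ∀ x, V x = 0 → V₁ x = 0)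
    (hg : g = -mulOp volume (relSignedRoot ∘ relPotential V V₁ 0) f)
    (hK' : HasKernel K' fun x y => deriv (fun w => sandwichedGreen (majorant V V₁) w x y) z) :
    pairing (opA' V z g) g = pairingWith (mulOp volume (relPotential V V₁ 0) f)
      (K' (mulOp volume (relPotential V V₁ 0) f)) := by
  obtain ⟨h1, h2, -⟩ := weighted_relations hV hV₁ hVpos hV₁supp hg
  have hK'' : HasKernel K' fun x y => (√(majorant V V₁ x) : ℂ) *
      deriv (fun w => green x y w) z * (√(majorant V V₁ y) : ℂ) := by
    have : (fun x y => deriv (fun w => sandwichedGreen (majorant V V₁) w x y) z) =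
        fun x y => (√(majorant V V₁ x) : ℂ) * deriv (fun w => green x y w) z *
          (√(majorant V V₁ y) : ℂ) := by
      funext x y
      simp only [sandwichedGreen]
      rw [deriv_mul_const_field, deriv_const_mul_field]
    rwa [this] at hK'
  have h3 := hK''.mul_integral_weighted (G := fun x y => deriv (fun w => green x y w) z) h2 h1
  rw [pairing, pairingWith_apply]
  refine integral_congr_ae ?_
  filter_upwards [h3, Lp.coeFn_neg (mulOp volume (relPotential V V₁ 0) f),
    Lp.coeFn_neg (K' (mulOp volume (relPotential V V₁ 0) f))] with x h4 h5 h6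
  rw [opA', h4, map_neg, h5, h6, Pi.neg_apply, Pi.neg_apply]
  ring

/-- `(B(z) g, g)` in terms of the symmetrized operators: by symmetry, both halves of `B(z)`
contribute the same amount. -/
lemma pairing_opB_eq (hV : Measurable V) (hV₁ : Measurable V₁) (hVpos : ∀ x, 0 ≤ V x)
    (hV₁supp : ∀ x, V x = 0 → V₁ x = 0)
    (hg : g = -mulOp volume (relSignedRoot ∘ relPotential V V₁ 0) f)
    (hK : HasKernel K (sandwichedGreen (majorant V V₁) z))
    (hsymm : ∀ u v : Lp ℂ 2 (volume : Measure (Space N)), ∫ x, K u x * v x = ∫ x, u x * K v x) :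
    pairing (opB V V₁ z g) g = pairingWith (mulOp volume (relPotential V V₁ 0) f)
      (K (mulOp volume (relPerturbation V V₁) f)) := by
  obtain ⟨h1, h2, h3⟩ := weighted_relations hV hV₁ hVpos hV₁supp hg
  have h4 := HasKernel.mul_integral_weighted (G := fun x y => green x y z) hK h3 h1
  have h5 := HasKernel.mul_integral_weighted (G := fun x y => green x y z) hK h2 h3
  set u₀ := mulOp volume (relPotential V V₁ 0) f with hu₀
  set u₁ := mulOp volume (relPerturbation V V₁) f with hu₁
  have hint : ∀ u v : Lp ℂ 2 (volume : Measure (Space N)), Integrable fun x => u x * v x :=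
    fun u v => (Lp.memLp u).integrable_mul (Lp.memLp v)
  have hae : (fun x => opB V V₁ z g x * g x) =ᵐ[volume]
      fun x => (1 / 2 : ℂ) * (u₁ x * K u₀ x) + (1 / 2 : ℂ) * (K u₁ x * u₀ x) := by
    filter_upwards [h4, h5, Lp.coeFn_neg u₀, Lp.coeFn_smul (-(1 / 2) : ℂ) u₁,
      Lp.coeFn_neg (K u₀), Lp.coeFn_smul (-(1 / 2) : ℂ) (K u₁)] with x h6 h7 h8 h9 h10 h11
    rw [opB, add_mul, h6, h7, map_neg, map_smul, h8, h9, h10, h11]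
    simp only [Pi.neg_apply, Pi.smul_apply, smul_eq_mul]
    ring
  rw [pairing, integral_congr_ae hae,
    integral_add ((hint _ _).const_mul _) ((hint _ _).const_mul _), integral_const_mul,
    integral_const_mul, ← hsymm, pairingWith_apply]
  ring

/-- If `f` is a null vector of `1 + K a` with a symmetric operator `K`, then pairing with `a f`
annihilates the range of `1 + K a`. -/
lemma pairingWith_add_eq_zero {a : Space N → ℝ} (ha : Measurable a) (ha1 : ∀ x, |a x| ≤ 1)
    (hsymm : ∀ u v : Lp ℂ 2 (volume : Measure (Space N)), ∫ x, K u x * v x = ∫ x, u x * K v x)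
    (hf : f + K (mulOp volume a f) = 0) (h : Lp ℂ 2 (volume : Measure (Space N))) :
    pairingWith (mulOp volume a f) (h + K (mulOp volume a h)) = 0 := by
  have h1 : K (mulOp volume a f) = -f := (neg_eq_of_add_eq_zero_right hf).symm
  rw [map_add, pairingWith_apply, pairingWith_apply, hsymm, h1, ← integral_mulOp_mul_comm ha ha1]
  have h2 : ∫ x, mulOp volume a h x * (-f : Lp ℂ 2 (volume : Measure (Space N))) x =
      -∫ x, mulOp volume a h x * f x := by
    rw [← integral_neg]
    refine integral_congr_ae ?_
    filter_upwards [Lp.coeFn_neg f] with x hx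
    rw [hx, Pi.neg_apply, mul_neg]
  rw [h2, add_neg_cancel]

/-- If `g(ε) = g₀ + O(ε)`, then also `|a(ε)|^(1/2) g(ε)` is within `O(ε)` of `a(0)^(1/2) g₀`:
the factor `a(0)^(1/2)` in `g₀` makes up for the failure of the square root to be Lipschitz. -/
lemma norm_mulOp_relRoot_sub_le (hV : Measurable V) (hV₁ : Measurable V₁) (hVpos : ∀ x, 0 ≤ V x)
    {ε : ℝ} (hε : |ε| ≤ 1) (hg : g = -mulOp volume (relSignedRoot ∘ relPotential V V₁ 0) f)
    (h : Lp ℂ 2 (volume : Measure (Space N))) :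
    ‖mulOp volume (relRoot ∘ relPotential V V₁ ε) h -
      mulOp volume (relRoot ∘ relPotential V V₁ 0) g‖ ≤ ‖h - g‖ + |ε| * ‖f‖ := by
  have hm := fun ε => measurable_relRoot.comp (measurable_relPotential hV hV₁ ε)
  have ha0 := abs_relPotential_le (V₁ := V₁) hVpos (ε := 0) (by simp)
  have haε := abs_relPotential_le (V₁ := V₁) hVpos hε
  have hb0 := fun x => abs_relRoot_le (ha0 x)
  have hbε := fun x => abs_relRoot_le (haε x)
  have hsplit : mulOp volume (relRoot ∘ relPotential V V₁ ε) h -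
      mulOp volume (relRoot ∘ relPotential V V₁ 0) g =
      mulOp volume (relRoot ∘ relPotential V V₁ ε) (h - g) +
      (mulOp volume (relRoot ∘ relPotential V V₁ ε) g -
        mulOp volume (relRoot ∘ relPotential V V₁ 0) g) := by
    rw [map_sub]
    abel
  rw [hsplit]
  refine (norm_add_le _ _).trans (add_le_add ?_ ?_)
  · refine Lp.norm_le_norm_of_ae_le ?_
    filter_upwards [coeFn_mulOp (μ := (volume : Measure (Space N))) (hm ε) hbε (h - g)] with x hx
    rw [hx, norm_mul, Complex.norm_real]
    exact mul_le_of_le_one_left (norm_nonneg _) (hbε x)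
  · refine Lp.norm_le_mul_norm_of_ae_le_mul ?_
    filter_upwards [coeFn_mulOp (μ := (volume : Measure (Space N))) (hm ε) hbε g,
      coeFn_mulOp (μ := (volume : Measure (Space N))) (hm 0) hb0 g,
      Lp.coeFn_sub (mulOp volume (relRoot ∘ relPotential V V₁ ε) g)
        (mulOp volume (relRoot ∘ relPotential V V₁ 0) g),
      coeFn_mulOp (μ := (volume : Measure (Space N)))
        (measurable_relSignedRoot.comp (measurable_relPotential hV hV₁ 0))
        (fun x => abs_relSignedRoot_le (ha0 x)) f,
      Lp.coeFn_neg (mulOp volume (relSignedRoot ∘ relPotential V V₁ 0) f)] with x h1 h2 h3 h4 h5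
    rw [h3, Pi.sub_apply, h1, h2, ← sub_mul, hg, h5, Pi.neg_apply, h4]
    simp only [Function.comp_apply]
    rw [relSignedRoot_of_nonneg (relPotential_zero_nonneg hVpos x), mul_neg, norm_neg, ← mul_assoc,
      norm_mul]
    gcongr
    have h6 := abs_relRoot_sub_mul_le (relPotential V V₁ 0 x) (relPotential V V₁ ε x)
    calc _ = |(relRoot (relPotential V V₁ ε x) - relRoot (relPotential V V₁ 0 x)) *
          relRoot (relPotential V V₁ 0 x)| := by
          rw [← Real.norm_eq_abs, ← Complex.norm_real]
          push_cast
          rfl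
      _ ≤ |relPotential V V₁ ε x - relPotential V V₁ 0 x| := h6
      _ = |ε| * |relPerturbation V V₁ x| := by rw [relPotential_eq, add_sub_cancel_left, abs_mul]
      _ ≤ |ε| := mul_le_of_le_one_right (abs_nonneg _) (abs_relPerturbation_le hVpos x)

end Pairings

/-! ### From the spectral parameter to the energy -/

section EnergyExpansion

lemma neg_sq_sub_expansion (z z₀ ν e : ℂ) :
    -z ^ 2 - (-z₀ ^ 2 - 2 * ν * z₀ * e) = -(z - z₀) ^ 2 - 2 * z₀ * (z - z₀ - ν * e) := by
  ring

lemma norm_neg_sq_sub_expansion_le {z z₀ ν : ℂ} {ε C : ℝ} (hε : |ε| ≤ 1)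
    (h : ‖z - z₀ - ν * ε‖ ≤ C * ε ^ 2) :
    ‖-z ^ 2 - (-z₀ ^ 2 - 2 * ν * z₀ * ε)‖ ≤ ((|C| + ‖ν‖) ^ 2 + 2 * ‖z₀‖ * |C|) * ε ^ 2 := by
  have h1 : ‖z - z₀ - ν * ε‖ ≤ |C| * ε ^ 2 := h.trans (by gcongr; exact le_abs_self C)
  have h2 : ε ^ 2 ≤ |ε| := by
    rw [← sq_abs, sq]
    exact mul_le_of_le_one_left (abs_nonneg ε) hε
  have h3 : ‖z - z₀‖ ≤ (|C| + ‖ν‖) * |ε| := by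
    calc ‖z - z₀‖ = ‖(z - z₀ - ν * ε) + ν * ε‖ := by rw [sub_add_cancel]
      _ ≤ |C| * ε ^ 2 + ‖ν‖ * |ε| := by
          refine (norm_add_le _ _).trans (add_le_add h1 ?_)
          rw [norm_mul, Complex.norm_real, Real.norm_eq_abs]
      _ ≤ |C| * |ε| + ‖ν‖ * |ε| := by gcongr
      _ = _ := by ring
  rw [neg_sq_sub_expansion]
  calc _ ≤ ‖z - z₀‖ ^ 2 + 2 * ‖z₀‖ * ‖z - z₀ - ν * ε‖ := by
        refine (norm_sub_le _ _).trans_eq ?_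
        rw [norm_neg, norm_pow, norm_mul, norm_mul, Complex.norm_ofNat]
    _ ≤ ((|C| + ‖ν‖) * |ε|) ^ 2 + 2 * ‖z₀‖ * (|C| * ε ^ 2) := by gcongr
    _ = _ := by
        rw [mul_pow, sq_abs]
        ring

lemma isBigO_neg_sq_sub_expansion {l : Filter ℝ} (hl : l ≤ 𝓝 0) {z : ℝ → ℂ} {z₀ ν : ℂ}
    (h : (fun ε : ℝ => z ε - z₀ - ν * (ε : ℂ)) =O[l] fun ε => ε ^ 2) :
    (fun ε : ℝ => -(z ε) ^ 2 - (-z₀ ^ 2 - 2 * ν * z₀ * (ε : ℂ))) =O[l] fun ε => ε ^ 2 := by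
  obtain ⟨C, hC⟩ := h.bound
  have hsmall : ∀ᶠ ε : ℝ in l, |ε| ≤ 1 := by
    filter_upwards [hl (Metric.closedBall_mem_nhds (0 : ℝ) one_pos)] with ε hε
    simpa using hε
  refine IsBigO.of_bound ((|C| + ‖ν‖) ^ 2 + 2 * ‖z₀‖ * |C|) ?_
  filter_upwards [hC, hsmall] with ε h1 h2
  rw [Real.norm_eq_abs, abs_of_nonneg (sq_nonneg ε)] at h1 ⊢
  exact norm_neg_sq_sub_expansion_le h2 h1

end EnergyExpansion

section Branch

/-- For an operator family differentiable at `z₀`, evaluating along `z → z₀` at a vector `h` within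
`O(|ε|)` of `h₀` changes the value by `O(|ε| + ‖z - z₀‖)`. -/
lemma isBigO_apply_sub_apply {E F : Type*} [NormedAddCommGroup E] [NormedSpace ℂ E]
    [NormedAddCommGroup F] [NormedSpace ℂ F] {K : ℂ → E →L[ℂ] F} {z₀ : ℂ}
    (hK : DifferentiableAt ℂ K z₀) {l : Filter ℝ} {z : ℝ → ℂ} (hz : Tendsto z l (𝓝 z₀))
    {h : ℝ → E} {h₀ : E} (hh : (fun ε => h ε - h₀) =O[l] fun ε => ε) :
    (fun ε => K (z ε) (h ε) - K z₀ h₀) =O[l] fun ε => |ε| + ‖z ε - z₀‖ := by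
  have hsplit : (fun ε => K (z ε) (h ε) - K z₀ h₀) =
      fun ε => K (z ε) (h ε - h₀) + (K (z ε) - K z₀) h₀ := by
    funext ε
    rw [map_sub, sub_apply]
    abel
  have hε : (fun ε : ℝ => ε) =O[l] fun ε => |ε| + ‖z ε - z₀‖ :=
    IsBigO.of_norm_le fun ε => by
      rw [Real.norm_eq_abs]
      exact le_add_of_nonneg_right (norm_nonneg _)
  have hz' : (fun ε => z ε - z₀) =O[l] fun ε => |ε| + ‖z ε - z₀‖ :=
    IsBigO.of_norm_le fun ε => le_add_of_nonneg_left (abs_nonneg ε)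
  have hbdd : (fun ε => K (z ε)) =O[l] fun _ => (1 : ℝ) :=
    (hK.continuousAt.tendsto.comp hz).isBigO_one ℝ
  have hlip : (fun ε => K (z ε) - K z₀) =O[l] fun ε => |ε| + ‖z ε - z₀‖ :=
    (hK.isBigO_sub.comp_tendsto hz).trans hz'
  rw [hsplit]
  refine IsBigO.add ?_ ?_
  · have h1 : (fun ε => K (z ε) (h ε - h₀)) =O[l] fun ε => ‖K (z ε)‖ * ‖h ε - h₀‖ :=
      IsBigO.of_norm_le fun ε => (K (z ε)).le_opNorm _
    refine h1.trans ?_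
    simpa using hbdd.norm_left.mul (hh.norm_left.trans hε)
  · have h1 : (fun ε => (K (z ε) - K z₀) h₀) =O[l] fun ε => ‖h₀‖ * ‖K (z ε) - K z₀‖ :=
      IsBigO.of_norm_le fun ε => by
        rw [mul_comm]
        exact (K (z ε) - K z₀).le_opNorm _
    exact h1.trans (hlip.norm_left.const_mul_left _)

end Branch

end SchrodingerResonance

theorem theorem10 (N : ℕ) (hN : 1 ≤ N)
    (V V₁ : Space N → ℝ) (hVmeas : Measurable V) (hV₁meas : Measurable V₁)
    -- `V` is positive; where it is allowed to vanish, so does `V₁`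
    (hVpos : ∀ x, 0 ≤ V x) (hV₁supp : ∀ x, V x = 0 → V₁ x = 0)
    -- both potentials decay exponentially, with rate `γ`
    (γ : ℝ) (hγ : 0 < γ) (p : ENNReal) (hp1 : 1 ≤ p) (hpN : (N : ENNReal) / 2 < p)
    (hVdecay : MemLp (fun x => Real.exp (γ * ‖x‖) * V x) p)
    (hV₁decay : MemLp (fun x => Real.exp (γ * ‖x‖) * V₁ x) p)
    -- `λ₀ = -z₀²` is a resonance, and `g₀` is a corresponding solution of `A(z₀) g₀ = 0`
    (l₀ z₀ : ℂ) (hl₀ : l₀ = -z₀ ^ 2) (hz₀ : z₀ ∈ sheet N) (hz₀γ : -(γ / 2) < z₀.re)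
    (g₀ : Lp ℂ 2 (volume : Measure (Space N))) (hg₀ : g₀ ≠ 0) (hker : InKernel V z₀ g₀)
    (hden : pairing (opA' V z₀ g₀) g₀ ≠ 0) :
    -- if `A(z₀)` has a one-dimensional kernel, then for small `ε` there is exactly one resonance
    -- of `-Δ + V + ε V₁` near `z₀`, and it has the stated expansion
    ((∀ g : Lp ℂ 2 (volume : Measure (Space N)), InKernel V z₀ g → ∃ c : ℂ, g = c • g₀) →
      ∃ δ > (0 : ℝ), ∃ ε₀ > (0 : ℝ), ∃ C : ℝ, ∀ ε : ℝ, |ε| < ε₀ →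
        ∃ z ∈ Metric.ball z₀ δ,
          IsResonanceAt (fun x => V x + ε * V₁ x) z ∧
          (∀ w ∈ Metric.ball z₀ δ, IsResonanceAt (fun x => V x + ε * V₁ x) w → w = z) ∧
          ‖-z ^ 2 - (l₀ - 2 * nu V V₁ z₀ g₀ * z₀ * ε)‖ ≤ C * ε ^ 2) ∧
    -- without any condition on the kernel, every branch of resonances `-z(ε)²` that starts at
    -- `λ₀`, with solutions `g(ε) = g₀ + O(ε)`, has the stated expansion
    (∀ (l : Filter ℝ), l ≤ 𝓝 0 → ∀ (z : ℝ → ℂ) (g : ℝ → Lp ℂ 2 (volume : Measure (Space N))),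
      Tendsto z l (𝓝 z₀) →
      (fun ε => g ε - g₀) =O[l] (fun ε => ε) →
      (∀ᶠ ε in l, InKernel (fun x => V x + ε * V₁ x) (z ε) (g ε)) →
      (fun ε => -(z ε) ^ 2 - (l₀ - 2 * nu V V₁ z₀ g₀ * z₀ * (ε : ℂ))) =O[l] (fun ε => ε ^ 2)) := by

  set Q := majorant V V₁ with hQdef
  have hQm : Measurable Q := measurable_majorant hVmeas hV₁meas
  have hQ0 : ∀ x, 0 ≤ Q x := majorant_nonneg hVpos
  obtain ⟨K, ρ, hρ, hsheet, hK, hKan, hK', hKc, hsymm⟩ := exists_sandwichedGreen_family hN hγ hp1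
    hpN hQm hQ0 (memLp_exp_mul_majorant hVdecay hV₁decay) hz₀ hz₀γ
  have hKz₀ := hK z₀ (Metric.mem_ball_self hρ)
  have ha : ∀ ε, Measurable (relPotential V V₁ ε) := measurable_relPotential hVmeas hV₁meas
  have ha1 : ∀ {ε : ℝ}, |ε| ≤ 1 → ∀ x, |relPotential V V₁ ε x| ≤ 1 :=
    fun hε => abs_relPotential_le hVpos hε
  have ha1' : ∀ x, |relPotential V V₁ 0 x| ≤ 1 := ha1 (by simp)
  have hU : ∀ x, V x = relPotential V V₁ 0 x * Q x := fun x => by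
    simpa using relPotential_mul_majorant (V₁ := V₁) hVpos 0 x
  set M₀ := mulOp volume (relPotential V V₁ 0) with hM₀
  set M₁ := mulOp volume (relPerturbation V V₁) with hM₁
  obtain ⟨hf₀, hg₀f⟩ := hker.spec (ha 0) ha1' hQ0 hU hKz₀
  set f₀ := K z₀ (mulOp volume (relRoot ∘ relPotential V V₁ 0) g₀) with hf₀def
  have hA' := pairing_opA'_eq hVmeas hV₁meas hVpos hV₁supp hg₀f hK'
  have hB := pairing_opB_eq hVmeas hV₁meas hVpos hV₁supp hg₀f hKz₀ hsymm
  have hnu : nu V V₁ z₀ g₀ =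
      -pairingWith (M₀ f₀) (K z₀ (M₁ f₀)) / pairingWith (M₀ f₀) (deriv K z₀ (M₀ f₀)) := by
    rw [nu, hA', hB]
  rw [hA'] at hden
  have hφ := pairingWith_add_eq_zero (ha 0) ha1' hsymm hf₀
  have hsum : ∀ {ε : ℝ}, |ε| ≤ 1 → ∀ f, mulOp volume (relPotential V V₁ ε) f =
      M₀ f + (ε : ℂ) • M₁ f := fun hε f => mulOp_relPotential hVmeas hV₁meas hVpos hε f
  rw [hnu, hl₀]
  refine ⟨fun hdim => ?_, fun l hl z g hz hg hInK => ?_⟩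
  · have hdim' : ∀ f, f + K z₀ (M₀ f) = 0 → ∃ c : ℂ, f = c • f₀ := fun f hf => by
      obtain ⟨h1, h2⟩ := inKernel_of_add_eq_zero (ha 0) ha1' hQ0 hU hKz₀ hf
      obtain ⟨c, hc⟩ := hdim _ h1
      exact ⟨c, by rw [← h2, hc, map_smul, map_smul, hf₀def]⟩
    obtain ⟨δ, hδ, hδρ, ε₀, hε₀, C, hC⟩ :=
      exists_unique_spectral_shift hKan hKc M₀ M₁ _ hφ f₀ hf₀ hdim' hden hρ
    refine ⟨δ, hδ, min ε₀ 1, lt_min hε₀ one_pos,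
      (|C| + ‖-pairingWith (M₀ f₀) (K z₀ (M₁ f₀)) /
        pairingWith (M₀ f₀) (deriv K z₀ (M₀ f₀))‖) ^ 2 + 2 * ‖z₀‖ * |C|, fun ε hε => ?_⟩
    have hε1 : |ε| ≤ 1 := (hε.trans_le (min_le_right _ _)).le
    have hres : ∀ w ∈ Metric.ball z₀ δ, (IsResonanceAt (fun x => V x + ε * V₁ x) w ↔
        ∃ f ≠ 0, f + K w (M₀ f + (ε : ℂ) • M₁ f) = 0) := fun w hw => by
      have hw' := Metric.ball_subset_ball hδρ hw
      rw [isResonanceAt_iff (ha ε) (ha1 hε1) hQ0 (relPotential_mul_majorant hVpos ε) (hsheet hw')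
        (hK w hw')]
      simp only [hsum hε1]
    obtain ⟨z, hz, h1, h2, h3⟩ := hC ε (hε.trans_le (min_le_left _ _))
    exact ⟨z, hz, (hres z hz).mpr h1, fun w hw hwr => h2 w hw ((hres w hw).mp hwr),
      norm_neg_sq_sub_expansion_le hε1 h3⟩
  · have hsmall : ∀ᶠ ε : ℝ in l, |ε| ≤ 1 := by
      filter_upwards [hl (Metric.closedBall_mem_nhds (0 : ℝ) one_pos)] with ε hε
      simpa using hε
    have hball : ∀ᶠ ε in l, z ε ∈ Metric.ball z₀ ρ := hz (Metric.ball_mem_nhds z₀ hρ)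
    -- the solutions `f(ε)` of the symmetrized equation inherit the closeness of `g(ε)` to `g₀`
    have hroot : (fun ε => mulOp volume (relRoot ∘ relPotential V V₁ ε) (g ε) -
        mulOp volume (relRoot ∘ relPotential V V₁ 0) g₀) =O[l] fun ε => ε := by
      have h1 : (fun ε => ‖g ε - g₀‖ + |ε| * ‖f₀‖) =O[l] fun ε : ℝ => ε :=
        hg.norm_left.add
          (((isBigO_refl _ l).abs_left.const_mul_left ‖f₀‖).congr_left fun ε => mul_comm _ _)
      refine IsBigO.trans (IsBigO.of_bound 1 ?_) h1
      filter_upwards [hsmall] with ε hε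
      rw [one_mul]
      exact (norm_mulOp_relRoot_sub_le hVmeas hV₁meas hVpos hε hg₀f (g ε)).trans (le_abs_self _)
    have hf := isBigO_apply_sub_apply hKan.differentiableAt hz hroot
    refine isBigO_neg_sq_sub_expansion hl
      (isBigO_spectral_shift hKan M₀ M₁ _ hφ f₀ hden hl hz hf ?_)
    filter_upwards [hsmall, hball, hInK] with ε h1 h2 h3
    rw [← hsum h1]
    exact (h3.spec (ha ε) (ha1 h1) hQ0 (relPotential_mul_majorant hVpos ε) (hK _ h2)).1
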